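/- Let $X$ be a completely regular Hausdorff space and $\beta X$ its Stone–Čech compactification. $C(X)$ is the ring of continuous functions $X\to\mathbb R$. For a family $\mathcal S$ of dense subsets of a space $Y$ that contains $Y$ and is closed under finite intersection, let $C[\mathcal S]=\varinjlim_{S\in\mathcal S}C(S)$ be the ring of continuous real functions defined on members of $\mathcal S$, two functions being identified when they agree on the intersection of their domains; it is a lattice-ordered ring under the pointwise order and a metric space under $d(f,g)=\sup\frac{|f-g|}{1+|f-g|}$. Put - $Q(X)=C[\mathcal V_0(X)]$, with $\mathcal V_0(X)$ the family of dense open subsets of $X$; restriction identifies $Q(\beta X)$ with $Q(X)$; - $\overline Q(X)=C[\mathcal G_0(\beta X)]$, with $\mathcal G_0(\beta X)$ the family of dense $G_\delta$ subsets of $\beta X$; thus $C(X)\subset Q(X)=Q(\beta X)\subset\overline Q(X)$; - $Q_L(X)$ (resp. $Q_F(X)$): the subring of those elements of $Q(X)$ that are represented by a locally constant continuous function (resp. a continuous function with finite range) on a dense open subset of $X$; - $C^*(X)$, $Q^*(X)$, $\overline Q^*(X)$: the subrings of bounded elements of $C(X)$, $Q(X)$, $\overline Q(X)$. An element $h\in\overline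 Q(X)$ is *$C$-bounded* if $|h|\le g$ for some $g\in C(X)$. An ordered ring $B$ is the *Dedekind completion* of a subring $A$ (with the induced order) if every nonempty subset of $B$ with an upper bound in $B$ has a supremum in $B$ and every element of $B$ is the supremum in $B$ of some subset of $A$. A commutative ring $B$ is a *ring of quotients* of a subring $A$ with the same unity if for all $b,b'\in B$ with $b'\neq0$ there is $a\in A$ with $ba\in A$ and $b'a\ne0$; it is the *maximal* one if every ring of quotients of $A$ embeds in $B$ over $A$. Theorem. 1. $Q(X)$ is the maximal ring of quotients of $C(X)$, and $\overline Q(X)$ is the metric completion of $Q(X)$ (the inclusion is isometric with dense image, and $\overline Q(X)$ is complete). 2. $\overline Q(X)$ is the Dedekind completion of $Q_L(X)$ and of $Q(X)$. 3. $\overline Q^*(X)$ is the Dedekind completion of $Q_F(X)$ and of $Q^*(X)$. 4. The $C$-bounded elements of $\overline Q(X)$ form a subring, which is the Dedekind completion of $C(X)$; and $\overline Q^*(X)$ is the Dedekind completion of $C^*(X)$. -/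

import Mathlib

namespace RingsOfFunctions

universe u

noncomputable section

/-! ### Direct limits of rings of continuous functions on dense sets -/

/-- A filter base of dense subsets of `Y` (containing the whole space `Y`). -/
structure DenseFilterBase (Y : Type u) [TopologicalSpace Y] where
  sets : Set (Set Y)
  univ_mem : Set.univ ∈ sets
  inter_mem : ∀ {S T : Set Y}, S ∈ sets → T ∈ sets → S ∩ T ∈ sets
  dense : ∀ {S : Set Y}, S ∈ sets → Dense S

/-- The base of all dense open subsets of `Y`. -/
def denseOpen (Y : Type u) [TopologicalSpace Y] : DenseFilterBase Y where
  sets := {S | IsOpen S ∧ Dense S}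
  univ_mem := ⟨isOpen_univ, dense_univ⟩
  inter_mem hS hT := ⟨hS.1.inter hT.1, hS.2.inter_of_isOpen_left hT.2 hS.1⟩
  dense hS := hS.2

/-- The base of all dense `G_δ` subsets of the Baire space `Y`. -/
def denseGdelta (Y : Type u) [TopologicalSpace Y] [BaireSpace Y] : DenseFilterBase Y where
  sets := {S | IsGδ S ∧ Dense S}
  univ_mem := ⟨IsGδ.univ, dense_univ⟩
  inter_mem hS hT := ⟨hS.1.inter hT.1, Dense.inter_of_Gδ hS.1 hT.1 hS.2 hT.2⟩
  dense hS := hS.2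

/-- The members of a base `𝓢`, directed by reverse inclusion. -/
structure Stage {Y : Type u} [TopologicalSpace Y] (𝓢 : DenseFilterBase Y) where
  carrier : Set Y
  mem : carrier ∈ 𝓢.sets

section

variable {Y : Type u} [TopologicalSpace Y] {𝓢 : DenseFilterBase Y}

instance : Preorder (Stage 𝓢) where
  le i j := j.carrier ⊆ i.carrier
  le_refl _ := subset_rfl
  le_trans _ _ _ h h' := h'.trans h

instance : Nonempty (Stage 𝓢) := ⟨⟨Set.univ, 𝓢.univ_mem⟩⟩

instance : IsDirectedOrder (Stage 𝓢) where
  directed i j := ⟨⟨i.carrier ∩ j.carrier, 𝓢.inter_mem i.mem j.mem⟩,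
    Set.inter_subset_left, Set.inter_subset_right⟩

/-- Restriction `C(S) → C(S')` for members `S ⊇ S'` of the base. -/
def res (i j : Stage 𝓢) (h : i ≤ j) : C(i.carrier, ℝ) →+* C(j.carrier, ℝ) where
  toFun f := f.comp ⟨Set.inclusion h, continuous_inclusion h⟩
  map_one' := rfl
  map_mul' _ _ := rfl
  map_zero' := rfl
  map_add' _ _ := rfl

instance : DirectedSystem (fun i : Stage 𝓢 => C(i.carrier, ℝ)) (fun i j h => res i j h) where
  map_self _ _ := rfl
  map_map _ _ _ _ _ _ := rfl

variable (𝓢) in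
/-- The ring `C[𝓢]`, the direct limit of the rings `C(S)`, `S ∈ 𝓢`, along restriction. -/
def LimitRing : Type u := DirectLimit (fun i : Stage 𝓢 => C(i.carrier, ℝ)) res

namespace LimitRing

instance : CommRing (LimitRing 𝓢) :=
  inferInstanceAs (CommRing (DirectLimit (fun i : Stage 𝓢 => C(i.carrier, ℝ)) res))

/-- The element of `C[𝓢]` represented by a continuous function on a member of `𝓢`. -/
def mk (i : Stage 𝓢) (f : C(i.carrier, ℝ)) : LimitRing 𝓢 :=
  (⟦⟨i, f⟩⟧ : DirectLimit (fun i : Stage 𝓢 => C(i.carrier, ℝ)) res)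

theorem mk_res {i j : Stage 𝓢} (h : i ≤ j) (f : C(i.carrier, ℝ)) : mk j (res i j h f) = mk i f :=
  DirectLimit.mk_apply (F := fun i : Stage 𝓢 => C(i.carrier, ℝ)) (f := res) i j f h

theorem denseRange_inclusion {i j : Stage 𝓢} (h : i ≤ j) :
    DenseRange (Set.inclusion h : j.carrier → i.carrier) := by
  rw [DenseRange, Subtype.dense_iff]
  intro x _
  have : (Subtype.val '' Set.range (Set.inclusion h) : Set Y) = j.carrier := by
    ext y; constructor
    · rintro ⟨_, ⟨z, rfl⟩, rfl⟩; exact z.2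
    · intro hy; exact ⟨_, ⟨⟨y, hy⟩, rfl⟩, rfl⟩
  rw [this]
  exact 𝓢.dense j.mem x

theorem res_le_res {i j : Stage 𝓢} (h : i ≤ j) {f g : C(i.carrier, ℝ)} :
    res i j h f ≤ res i j h g ↔ f ≤ g := by
  refine ⟨fun H x => ?_, fun H x => H _⟩
  have hc : IsClosed {x | f x ≤ g x} := isClosed_le f.continuous g.continuous
  exact (denseRange_inclusion h).induction_on (p := fun x => f x ≤ g x) x hc fun a => H a

theorem res_injective (i j : Stage 𝓢) (h : i ≤ j) : Function.Injective (res i j h) :=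
  fun _ _ H => le_antisymm ((res_le_res h).1 H.le) ((res_le_res h).1 H.ge)

theorem mk_injective (i : Stage 𝓢) : Function.Injective (mk i) :=
  DirectLimit.mk_injective _ res_injective i

theorem ind {p : LimitRing 𝓢 → Prop} (h : ∀ i f, p (mk i f)) (a : LimitRing 𝓢) : p a :=
  DirectLimit.induction _ h a

theorem ind₂ {p : LimitRing 𝓢 → LimitRing 𝓢 → Prop} (h : ∀ i f g, p (mk i f) (mk i g))
    (a b : LimitRing 𝓢) : p a b :=
  DirectLimit.induction₂ _ h a b

theorem ind₃ {p : LimitRing 𝓢 → LimitRing 𝓢 → LimitRing 𝓢 → Prop}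
    (h : ∀ i f g k, p (mk i f) (mk i g) (mk i k)) (a b c : LimitRing 𝓢) : p a b c :=
  DirectLimit.induction₃ _ h a b c

theorem mk_add (i : Stage 𝓢) (f g) : mk i f + mk i g = mk i (f + g) := DirectLimit.add_def ..
theorem mk_mul (i : Stage 𝓢) (f g) : mk i f * mk i g = mk i (f * g) := DirectLimit.mul_def ..
theorem mk_neg (i : Stage 𝓢) (f) : -mk i f = mk i (-f) := rfl
theorem mk_zero (i : Stage 𝓢) : mk i 0 = 0 := (DirectLimit.zero_def i).symm
theorem mk_one (i : Stage 𝓢) : mk i 1 = 1 := (DirectLimit.one_def i).symm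
theorem mk_natCast (i : Stage 𝓢) (n : ℕ) : mk i n = n := (DirectLimit.natCast_def n i).symm

/-- The pointwise order: `a ≤ b` when `f ≤ g` for some representatives `f` of `a` and `g` of `b`
on a common member of the base. -/
instance : LE (LimitRing 𝓢) where
  le a b := ∃ (i : Stage 𝓢) (f g : C(i.carrier, ℝ)), a = mk i f ∧ b = mk i g ∧ f ≤ g

theorem mk_le_mk {i : Stage 𝓢} {f g : C(i.carrier, ℝ)} : mk i f ≤ mk i g ↔ f ≤ g := by
  constructor
  · rintro ⟨j, f', g', hf, hg, H⟩
    obtain ⟨k, hi, hj⟩ := exists_ge_ge i j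
    rw [← mk_res hi, ← mk_res hj] at hf hg
    rw [← res_le_res hi, mk_injective k hf, mk_injective k hg, res_le_res hj]
    exact H
  · intro H; exact ⟨i, f, g, rfl, rfl, H⟩

instance : Max (LimitRing 𝓢) where
  max := DirectLimit.map₂ res res res (fun _ f g => f ⊔ g) fun _ _ _ _ _ => rfl

instance : Min (LimitRing 𝓢) where
  min := DirectLimit.map₂ res res res (fun _ f g => f ⊓ g) fun _ _ _ _ _ => rfl

theorem mk_sup (i : Stage 𝓢) (f g) : mk i f ⊔ mk i g = mk i (f ⊔ g) := DirectLimit.map₂_def ..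
theorem mk_inf (i : Stage 𝓢) (f g) : mk i f ⊓ mk i g = mk i (f ⊓ g) := DirectLimit.map₂_def ..

instance : Lattice (LimitRing 𝓢) where
  le_refl := ind fun _ _ => mk_le_mk.2 le_rfl
  le_trans := ind₃ fun _ _ _ _ h h' => mk_le_mk.2 ((mk_le_mk.1 h).trans (mk_le_mk.1 h'))
  le_antisymm := ind₂ fun _ _ _ h h' =>
    congrArg _ (le_antisymm (mk_le_mk.1 h) (mk_le_mk.1 h'))
  sup := (· ⊔ ·)
  inf := (· ⊓ ·)
  le_sup_left := ind₂ fun _ _ _ => by rw [mk_sup, mk_le_mk]; exact le_sup_left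
  le_sup_right := ind₂ fun _ _ _ => by rw [mk_sup, mk_le_mk]; exact le_sup_right
  sup_le := ind₃ fun _ _ _ _ => by
    rw [mk_sup, mk_le_mk, mk_le_mk, mk_le_mk]; exact sup_le
  inf_le_left := ind₂ fun _ _ _ => by rw [mk_inf, mk_le_mk]; exact inf_le_left
  inf_le_right := ind₂ fun _ _ _ => by rw [mk_inf, mk_le_mk]; exact inf_le_right
  le_inf := ind₃ fun _ _ _ _ => by
    rw [mk_inf, mk_le_mk, mk_le_mk, mk_le_mk]; exact le_inf

instance : IsOrderedRing (LimitRing 𝓢) where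
  add_le_add_left := fun a b h c => by
    induction a, b, c using ind₃ with | h i f g k => ?_
    rw [mk_add, mk_add, mk_le_mk]
    exact fun x => add_le_add_left (mk_le_mk.1 h x) _
  zero_le_one := by
    obtain ⟨i⟩ : Nonempty (Stage 𝓢) := inferInstance
    rw [← mk_zero i, ← mk_one i, mk_le_mk]
    exact fun x => zero_le_one
  mul_le_mul_of_nonneg_left := fun a ha b c h => by
    induction a, b, c using ind₃ with | h i f g k => ?_
    rw [← mk_zero i, mk_le_mk] at ha
    simp only [mk_mul, mk_le_mk] at h ⊢
    exact fun x => mul_le_mul_of_nonneg_left (h x) (ha x)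
  mul_le_mul_of_nonneg_right := fun a ha b c h => by
    induction a, b, c using ind₃ with | h i f g k => ?_
    rw [← mk_zero i, mk_le_mk] at ha
    simp only [mk_mul, mk_le_mk] at h ⊢
    exact fun x => mul_le_mul_of_nonneg_right (h x) (ha x)

/-! The metric `‖(f - g) / (1 + |f - g|)‖` (sup norm) on `C[𝓢]`. -/

/-- The supremum of `|f - g| / (1 + |f - g|)` over `S`. -/
def stageDist (i : Stage 𝓢) (f g : C(i.carrier, ℝ)) : ℝ :=
  ⨆ x : i.carrier, |f x - g x| / (1 + |f x - g x|)

theorem ratio_le_one (t : ℝ) : |t| / (1 + |t|) ≤ 1 := by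
  rw [div_le_one (by positivity)]; linarith [abs_nonneg t]

theorem bddAbove_ratio (i : Stage 𝓢) (f g : C(i.carrier, ℝ)) :
    BddAbove (Set.range fun x : i.carrier => |f x - g x| / (1 + |f x - g x|)) :=
  ⟨1, by rintro _ ⟨x, rfl⟩; exact ratio_le_one _⟩

theorem le_stageDist (i : Stage 𝓢) (f g : C(i.carrier, ℝ)) (x : i.carrier) :
    |f x - g x| / (1 + |f x - g x|) ≤ stageDist i f g :=
  le_ciSup (bddAbove_ratio i f g) x

theorem stageDist_nonneg (i : Stage 𝓢) (f g : C(i.carrier, ℝ)) : 0 ≤ stageDist i f g :=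
  Real.iSup_nonneg fun _ => by positivity

theorem stageDist_le (i : Stage 𝓢) (f g : C(i.carrier, ℝ)) {c : ℝ} (hc : 0 ≤ c)
    (h : ∀ x, |f x - g x| / (1 + |f x - g x|) ≤ c) : stageDist i f g ≤ c :=
  Real.iSup_le h hc

theorem stageDist_res (i j : Stage 𝓢) (h : i ≤ j) (f g : C(i.carrier, ℝ)) :
    stageDist i f g = stageDist j (res i j h f) (res i j h g) := by
  apply le_antisymm
  · refine stageDist_le _ _ _ (stageDist_nonneg _ _ _) fun x => ?_
    refine (denseRange_inclusion h).induction_on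
      (p := fun x => |f x - g x| / (1 + |f x - g x|) ≤
        stageDist j (res i j h f) (res i j h g)) x ?_ fun a =>
          le_stageDist j (res i j h f) (res i j h g) a
    refine isClosed_le (Continuous.div (by fun_prop) (by fun_prop) fun x => ?_) continuous_const
    positivity
  · exact stageDist_le _ _ _ (stageDist_nonneg _ _ _) fun x =>
      le_stageDist i f g (Set.inclusion h x)

instance : Dist (LimitRing 𝓢) where
  dist := DirectLimit.lift₂ res res stageDist stageDist_res

theorem dist_mk (i : Stage 𝓢) (f g : C(i.carrier, ℝ)) :
    dist (mk i f) (mk i g) = stageDist i f g := DirectLimit.lift₂_def ..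

theorem ratio_triangle (a b c : ℝ) :
    |a - c| / (1 + |a - c|) ≤ |a - b| / (1 + |a - b|) + |b - c| / (1 + |b - c|) := by
  have h := abs_sub_le a b c
  have h0 := abs_nonneg (a - c)
  have h1 := abs_nonneg (a - b)
  have h2 := abs_nonneg (b - c)
  generalize |a - c| = r at *
  generalize |a - b| = s at *
  generalize |b - c| = t at *
  rw [div_add_div _ _ (by positivity) (by positivity), div_le_div_iff₀ (by positivity)
    (by positivity)]
  nlinarith [mul_nonneg h1 h2, mul_nonneg h0 (mul_nonneg h1 h2)]

instance : MetricSpace (LimitRing 𝓢) where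
  dist_self := ind fun i f => by
    rw [dist_mk]
    exact le_antisymm (stageDist_le _ _ _ le_rfl fun x => by simp) (stageDist_nonneg _ _ _)
  dist_comm := ind₂ fun i f g => by simp only [dist_mk, stageDist, abs_sub_comm]
  dist_triangle := ind₃ fun i f g k => by
    simp only [dist_mk]
    refine stageDist_le _ _ _ (add_nonneg (stageDist_nonneg _ _ _) (stageDist_nonneg _ _ _))
      fun x => (ratio_triangle _ (g x) _).trans ?_
    exact add_le_add (le_stageDist _ _ _ x) (le_stageDist _ _ _ x)
  eq_of_dist_eq_zero := fun {a b} h => by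
    induction a, b using ind₂ with | h i f g => ?_
    refine congrArg _ (ContinuousMap.ext fun x => ?_)
    rw [dist_mk] at h
    have h1 := (le_stageDist i f g x).trans h.le
    have h2 : |f x - g x| / (1 + |f x - g x|) = 0 := le_antisymm h1 (by positivity)
    rcases div_eq_zero_iff.1 h2 with h3 | h3
    · exact sub_eq_zero.1 (abs_eq_zero.1 h3)
    · linarith [abs_nonneg (f x - g x)]

/-- A continuous function on the whole space, as an element of `C[𝓢]`. -/
def ofContinuous : C(Y, ℝ) →+* LimitRing 𝓢 where
  toFun f := mk ⟨Set.univ, 𝓢.univ_mem⟩ (f.comp ⟨Subtype.val, continuous_subtype_val⟩)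
  map_one' := mk_one _
  map_mul' f g := by rw [mk_mul]; rfl
  map_zero' := mk_zero _
  map_add' f g := by rw [mk_add]; rfl

/-- The map `C(S) → C[𝓣]`, `f ↦ f ∘ ι`, for a single member `S` of `𝓢`. -/
def pullbackStage {X : Type u} [TopologicalSpace X] {𝓣 : DenseFilterBase X} (ι : X → Y)
    (hc : Continuous ι) (h : ∀ S ∈ 𝓢.sets, ι ⁻¹' S ∈ 𝓣.sets) (i : Stage 𝓢) :
    C(i.carrier, ℝ) →+* LimitRing 𝓣 where
  toFun f := mk ⟨ι ⁻¹' i.carrier, h _ i.mem⟩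
    (f.comp ⟨i.carrier.restrictPreimage ι, hc.restrictPreimage⟩)
  map_one' := mk_one _
  map_zero' := mk_zero _
  map_mul' f g := by rw [mk_mul]; rfl
  map_add' f g := by rw [mk_add]; rfl

/-- For a continuous map `ι : X → Y` such that preimages of members of `𝓢` are members of `𝓣`,
the ring homomorphism `C[𝓢] → C[𝓣]`, `f ↦ f ∘ ι`. -/
def pullback {X : Type u} [TopologicalSpace X] {𝓣 : DenseFilterBase X} (ι : X → Y)
    (hc : Continuous ι) (h : ∀ S ∈ 𝓢.sets, ι ⁻¹' S ∈ 𝓣.sets) : LimitRing 𝓢 →+* LimitRing 𝓣 where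
  toFun := DirectLimit.lift res (fun i f => pullbackStage ι hc h i f) fun i j hij f =>
    (mk_res (i := ⟨ι ⁻¹' i.carrier, h _ i.mem⟩) (j := ⟨ι ⁻¹' j.carrier, h _ j.mem⟩)
      (Set.preimage_mono hij) (f.comp ⟨i.carrier.restrictPreimage ι, hc.restrictPreimage⟩)).symm
  map_one' := by
    rw [← mk_one ⟨Set.univ, 𝓢.univ_mem⟩]; exact map_one (pullbackStage ι hc h _)
  map_zero' := by
    rw [← mk_zero ⟨Set.univ, 𝓢.univ_mem⟩]; exact map_zero (pullbackStage ι hc h _)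
  map_mul' := ind₂ fun i f g => by
    rw [mk_mul]; exact map_mul (pullbackStage ι hc h i) f g
  map_add' := ind₂ fun i f g => by
    rw [mk_add]; exact map_add (pullbackStage ι hc h i) f g

theorem pullback_mk {X : Type u} [TopologicalSpace X] {𝓣 : DenseFilterBase X} (ι : X → Y)
    (hc : Continuous ι) (h : ∀ S ∈ 𝓢.sets, ι ⁻¹' S ∈ 𝓣.sets) (i : Stage 𝓢)
    (f : C(i.carrier, ℝ)) :
    pullback ι hc h (mk i f) = mk ⟨ι ⁻¹' i.carrier, h _ i.mem⟩
      (f.comp ⟨i.carrier.restrictPreimage ι, hc.restrictPreimage⟩) := rfl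

theorem monotone_pullback {X : Type u} [TopologicalSpace X] {𝓣 : DenseFilterBase X} (ι : X → Y)
    (hc : Continuous ι) (h : ∀ S ∈ 𝓢.sets, ι ⁻¹' S ∈ 𝓣.sets) :
    Monotone (pullback (𝓣 := 𝓣) ι hc h) := by
  intro a b
  revert a b
  refine ind₂ fun i f g hab => ?_
  rw [pullback_mk, pullback_mk, mk_le_mk]
  exact fun x => mk_le_mk.1 hab _

theorem monotone_ofContinuous : Monotone (ofContinuous (𝓢 := 𝓢)) := fun _ _ h =>
  mk_le_mk.2 fun x => h x

/-- The elements of `C[𝓢]` that have a representative in a given family of subrings of the rings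
`C(S)`, closed under restriction. -/
def subringOf (P : ∀ i : Stage 𝓢, Subring C(i.carrier, ℝ))
    (hP : ∀ i j h, ∀ f ∈ P i, res i j h f ∈ P j) : Subring (LimitRing 𝓢) where
  carrier := {a | ∃ i, ∃ f ∈ P i, a = mk i f}
  one_mem' := ⟨⟨Set.univ, 𝓢.univ_mem⟩, 1, one_mem _, (mk_one _).symm⟩
  zero_mem' := ⟨⟨Set.univ, 𝓢.univ_mem⟩, 0, zero_mem _, (mk_zero _).symm⟩
  mul_mem' := by
    rintro _ _ ⟨i, f, hf, rfl⟩ ⟨j, g, hg, rfl⟩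
    obtain ⟨k, hi, hj⟩ := exists_ge_ge i j
    exact ⟨k, _, mul_mem (hP i k hi f hf) (hP j k hj g hg), by rw [← mk_mul, mk_res, mk_res]⟩
  add_mem' := by
    rintro _ _ ⟨i, f, hf, rfl⟩ ⟨j, g, hg, rfl⟩
    obtain ⟨k, hi, hj⟩ := exists_ge_ge i j
    exact ⟨k, _, add_mem (hP i k hi f hf) (hP j k hj g hg), by rw [← mk_add, mk_res, mk_res]⟩
  neg_mem' := by
    rintro _ ⟨i, f, hf, rfl⟩
    exact ⟨i, _, neg_mem hf, by rw [mk_neg]⟩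

end LimitRing

end

/-! ### Bounded elements -/

theorem mul_mem_bounds {A : Type u} [CommRing A] [PartialOrder A] [IsOrderedRing A]
    {a b u v : A} (ha : -u ≤ a) (ha' : a ≤ u) (hb : -v ≤ b) (hb' : b ≤ v)
    (hu : 0 ≤ u) (hv : 0 ≤ v) : -(3 * (u * v)) ≤ a * b ∧ a * b ≤ 3 * (u * v) := by
  have a1 : 0 ≤ u + a := by simpa [add_comm] using sub_nonneg.2 ha
  have a2 : 0 ≤ u - a := sub_nonneg.2 ha'
  have b1 : 0 ≤ v + b := by simpa [add_comm] using sub_nonneg.2 hb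
  have b2 : 0 ≤ v - b := sub_nonneg.2 hb'
  constructor <;> rw [← sub_nonneg]
  · have : a * b - -(3 * (u * v)) =
        (u + a) * (v + b) + (u * (v - b) + v * (u - a)) := by ring
    rw [this]; positivity
  · have : 3 * (u * v) - a * b =
        (u + a) * (v - b) + (u * (v + b) + v * (u - a)) := by ring
    rw [this]; positivity

/-- The subring of bounded elements of a partially ordered ring: those `a` with `-m ≤ a ≤ m` for
some natural number `m`. In `C(X)` and in `C[𝓢]` these are the bounded functions. -/
def boundedElements (A : Type u) [CommRing A] [PartialOrder A] [IsOrderedRing A] : Subring A where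
  carrier := {a | ∃ m : ℕ, -(m : A) ≤ a ∧ a ≤ m}
  one_mem' := ⟨1, by
    have : (0 : A) ≤ 1 := zero_le_one
    constructor
    · rw [Nat.cast_one]; exact (neg_nonpos.2 this).trans this
    · simp⟩
  zero_mem' := ⟨0, by simp⟩
  add_mem' := by
    rintro a b ⟨m, ha, ha'⟩ ⟨n, hb, hb'⟩
    refine ⟨m + n, ?_, ?_⟩
    · rw [Nat.cast_add, neg_add]; exact add_le_add ha hb
    · rw [Nat.cast_add]; exact add_le_add ha' hb'
  neg_mem' := by
    rintro a ⟨m, ha, ha'⟩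
    exact ⟨m, neg_le_neg ha', neg_le.1 ha⟩
  mul_mem' := by
    rintro a b ⟨m, ha, ha'⟩ ⟨n, hb, hb'⟩
    refine ⟨3 * (m * n), ?_⟩
    push_cast
    exact mul_mem_bounds ha ha' hb hb' (Nat.cast_nonneg m) (Nat.cast_nonneg n)

theorem map_boundedElements {A B : Type u} [CommRing A] [PartialOrder A] [IsOrderedRing A]
    [CommRing B] [PartialOrder B] [IsOrderedRing B] (φ : A →+* B) (hφ : Monotone φ) :
    ∀ a ∈ boundedElements A, φ a ∈ boundedElements B := by
  rintro a ⟨m, h, h'⟩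
  exact ⟨m, by simpa using hφ h, by simpa using hφ h'⟩

/-! ### The rings `Q(X)` and `Q̄(X)` -/

section

variable (X : Type u) [TopologicalSpace X]

/-- `Q(X)`: continuous functions on dense open subsets of `X`, modulo agreement on the
intersection of the domains. -/
abbrev Q : Type u := LimitRing (denseOpen X)

/-- `Q̄(X)`: continuous functions on dense `G_δ` subsets of the Stone–Čech compactification `βX`,
modulo agreement on the intersection of the domains. -/
abbrev Qbar : Type u := LimitRing (denseGdelta (StoneCech X))

variable {X}

theorem preimage_mem_denseOpen [CompletelyRegularSpace X] :
    ∀ S ∈ (denseOpen (StoneCech X)).sets,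
      (stoneCechUnit : X → StoneCech X) ⁻¹' S ∈ (denseOpen X).sets := fun _ hS =>
  ⟨hS.1.preimage continuous_stoneCechUnit, by
    refine dense_iff_inter_open.2 fun U hU ⟨x, hx⟩ => ?_
    obtain ⟨O, hO, rfl⟩ := isInducing_stoneCechUnit.isOpen_iff.1 hU
    have hne : (O ∩ _).Nonempty := hS.2.inter_open_nonempty O hO ⟨_, hx⟩
    obtain ⟨y, hy⟩ := denseRange_stoneCechUnit.exists_mem_open (hO.inter hS.1) hne
    exact ⟨y, hy⟩⟩

variable (X)

/-- The restriction homomorphism `Q(βX) → Q(X)`, taking a continuous function on a dense open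
subset `W` of `βX` to its restriction to `W ∩ X`. -/
def restrictQ [T35Space X] : Q (StoneCech X) →+* Q X :=
  LimitRing.pullback stoneCechUnit continuous_stoneCechUnit preimage_mem_denseOpen

/-- The inclusion `Q(βX) → Q̄(X)`: a dense open subset of `βX` is a dense `G_δ`. -/
def inclQ : Q (StoneCech X) →+* Qbar X :=
  LimitRing.pullback id continuous_id fun _ hS => ⟨hS.1.isGδ, hS.2⟩

variable {X}

theorem exists_stoneCech_extension (f : X → ℝ) (hf : Continuous f) (M : ℝ) (hM : ∀ x, |f x| ≤ M) :
    ∃ F : C(StoneCech X, ℝ), ∀ x, F (stoneCechUnit x) = f x := by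
  let g : X → Set.Icc (-M) M := fun x => ⟨f x, abs_le.1 (hM x)⟩
  have hg : Continuous g := hf.subtype_mk _
  refine ⟨⟨fun y => (stoneCechExtend hg y).1,
    continuous_subtype_val.comp (continuous_stoneCechExtend hg)⟩, fun x => ?_⟩
  exact congrArg Subtype.val (stoneCechExtend_stoneCechUnit hg x)

/-- A continuous function on an open subset of `X` agrees, near each point of its domain, with
the restriction of a continuous function on `βX`. -/
theorem exists_local_extension [T35Space X] {V : Set X} (hV : IsOpen V) (f : C(V, ℝ)) (x : V) :
    ∃ O : Set (StoneCech X), IsOpen O ∧ stoneCechUnit x.1 ∈ O ∧ ∃ h : C(StoneCech X, ℝ),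
      ∀ z : V, stoneCechUnit z.1 ∈ O → h (stoneCechUnit z.1) = f z := by
  classical
  obtain ⟨e, he, hex, heV⟩ :=
    CompletelyRegularSpace.completely_regular_isOpen x.1 V hV x.2
  -- a cut-off function, equal to one near the given point and vanishing outside the open set
  let d : X → ℝ := fun z => min 1 (2 * (1 - (e z : ℝ)))
  have hd : Continuous d := by
    have : Continuous fun z => (e z : ℝ) := continuous_subtype_val.comp he
    fun_prop
  have hd0 : ∀ z, 0 ≤ d z := fun z => le_min zero_le_one (by linarith [(e z).2.2])
  have hd1 : ∀ z, d z ≤ 1 := fun z => min_le_left _ _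
  have hdV : ∀ z, z ∉ V → d z = 0 := fun z hz => by
    have : (e z : ℝ) = 1 := by rw [heV hz]; rfl
    simp [d, this]
  let p : V → ℝ := fun z => max (f x - 1) (min (f x + 1) (f z))
  have hp : Continuous p := by fun_prop
  have hpM : ∀ z, |p z| ≤ |f x| + 1 := fun z => by
    have h1 : f x - 1 ≤ p z := le_max_left _ _
    have h2 : p z ≤ f x + 1 := max_le (by linarith) (min_le_left _ _)
    exact abs_le.2 ⟨by linarith [neg_abs_le (f x)], by linarith [le_abs_self (f x)]⟩
  let k : X → ℝ := fun z => if hz : z ∈ V then d z * p ⟨z, hz⟩ else 0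
  have hkd : ∀ z, |k z| ≤ d z * (|f x| + 1) := fun z => by
    by_cases hz : z ∈ V
    · simp only [k, hz, dite_true, abs_mul, abs_of_nonneg (hd0 z)]
      exact mul_le_mul_of_nonneg_left (hpM _) (hd0 z)
    · simp [k, hz, hdV z hz]
  have hk : Continuous k := by
    rw [continuous_iff_continuousAt]
    intro z
    by_cases hz : z ∈ V
    · have : ContinuousOn k V := by
        rw [continuousOn_iff_continuous_domRestrict]
        have : V.domRestrict k = fun w : V => d w * p w := by
          funext w; simp [k, Set.domRestrict]
        rw [this]
        exact (hd.comp continuous_subtype_val).mul hp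
      exact this.continuousAt (hV.mem_nhds hz)
    · have hkz : k z = 0 := by simp [k, hz]
      rw [ContinuousAt, hkz]
      refine squeeze_zero_norm (fun w => hkd w) ?_
      have : Continuous fun w => d w * (|f x| + 1) := by fun_prop
      simpa [hdV z hz] using this.tendsto z
  obtain ⟨h, hh⟩ := exists_stoneCech_extension k hk (|f x| + 1) fun z =>
    (hkd z).trans (mul_le_of_le_one_left (by positivity) (hd1 z))
  have hNV : IsOpen {z : V | |f z - f x| < 1 ∧ (e z : ℝ) < 1 / 2} := by
    have : Continuous fun z : V => (e z : ℝ) :=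
      continuous_subtype_val.comp (he.comp continuous_subtype_val)
    exact (isOpen_lt (f := fun z : V => |f z - f x|) (by fun_prop) continuous_const).inter (isOpen_lt this continuous_const)
  have hN := hV.isOpenMap_subtype_val _ hNV
  obtain ⟨O, hO, hON⟩ := isInducing_stoneCechUnit.isOpen_iff.1 hN
  refine ⟨O, hO, ?_, h, fun z hz => ?_⟩
  · change x.1 ∈ stoneCechUnit ⁻¹' O
    rw [hON]
    exact ⟨x, ⟨by simp, by rw [hex]; norm_num⟩, rfl⟩
  · have hz' : z.1 ∈ stoneCechUnit ⁻¹' O := hz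
    rw [hON] at hz'
    obtain ⟨w, ⟨hw1, hw2⟩, hwz⟩ := hz'
    obtain rfl : w = z := Subtype.ext hwz
    rw [hh]
    have hd' : d w = 1 := min_eq_left (by linarith)
    have hp' : p w = f w := by
      rw [abs_lt] at hw1
      simp only [p]
      rw [min_eq_right (by linarith), max_eq_right (by linarith)]
    simp [k, hd', hp']

theorem restrictQ_le_iff [T35Space X] {a b : Q (StoneCech X)} :
    restrictQ X a ≤ restrictQ X b ↔ a ≤ b := by
  refine ⟨?_, fun h => LimitRing.monotone_pullback _ _ _ h⟩
  induction a, b using LimitRing.ind₂ with | h i f g => ?_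
  intro hab
  have hab' := LimitRing.mk_le_mk.1 hab
  rw [LimitRing.mk_le_mk]
  intro y
  have hcl : IsClosed {y | f y ≤ g y} := isClosed_le f.continuous g.continuous
  have hdr : Dense {y : i.carrier | ∃ x : X, stoneCechUnit x = y.1} := by
    rw [Subtype.dense_iff]
    intro y hy
    rw [mem_closure_iff]
    intro O hO hyO
    obtain ⟨x, hx⟩ := denseRange_stoneCechUnit.exists_mem_open (hO.inter i.mem.1) ⟨y, hyO, hy⟩
    exact ⟨_, hx.1, ⟨⟨_, hx.2⟩, ⟨x, rfl⟩, rfl⟩⟩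
  have hsub : closure {y : i.carrier | ∃ x : X, stoneCechUnit x = y.1} ⊆ {y | f y ≤ g y} := by
    refine closure_minimal ?_ hcl
    rintro ⟨_, hy⟩ ⟨x, rfl⟩
    exact hab' ⟨x, hy⟩
  exact hsub (hdr y)

/-- Every continuous function on a dense open subset of `X` extends uniquely to a dense open
subset of `βX`: restriction identifies `Q(βX)` with `Q(X)`. -/
theorem restrictQ_bijective [T35Space X] : Function.Bijective (restrictQ X) := by
  constructor
  · intro a b hab
    exact le_antisymm (restrictQ_le_iff.1 hab.le) (restrictQ_le_iff.1 hab.ge)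
  · intro a
    induction a using LimitRing.ind with | h i f => ?_
    obtain ⟨V, hVo, hVd⟩ := i
    dsimp only at f
    -- pairs consisting of an open set of the compactification and a function extending `f` there
    let good : Set (StoneCech X) → C(StoneCech X, ℝ) → Prop := fun O h =>
      IsOpen O ∧ ∀ z : V, stoneCechUnit z.1 ∈ O → h (stoneCechUnit z.1) = f z
    let W : Set (StoneCech X) := {y | ∃ O h, good O h ∧ y ∈ O}
    have hWo : IsOpen W := by
      rw [isOpen_iff_forall_mem_open]
      rintro y ⟨O, h, hg, hy⟩
      exact ⟨O, fun z hz => ⟨O, h, hg, hz⟩, hg.1, hy⟩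
    have hVW : ∀ z : V, stoneCechUnit z.1 ∈ W := fun z => by
      obtain ⟨O, hO, hz, h, hh⟩ := exists_local_extension hVo f z
      exact ⟨O, h, ⟨hO, hh⟩, hz⟩
    have hVdense : Dense (stoneCechUnit '' V : Set (StoneCech X)) :=
      denseRange_stoneCechUnit.dense_image continuous_stoneCechUnit hVd
    have hWd : Dense W := hVdense.mono (by rintro _ ⟨z, hz, rfl⟩; exact hVW ⟨z, hz⟩)
    have huniq : ∀ O h O' h', good O h → good O' h' → ∀ y ∈ O ∩ O', h y = h' y := by
      intro O h O' h' hg hg' y hy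
      by_contra hne
      have hopen : IsOpen ((O ∩ O') ∩ {y | h y ≠ h' y}) :=
        (hg.1.inter hg'.1).inter (isOpen_ne_fun h.continuous h'.continuous)
      obtain ⟨_, hz1, z, hz, rfl⟩ := hVdense.inter_open_nonempty _ hopen ⟨y, hy, hne⟩
      exact hz1.2 ((hg.2 ⟨z, hz⟩ hz1.1.1).trans (hg'.2 ⟨z, hz⟩ hz1.1.2).symm)
    choose! O h hgood hmem using fun (y : StoneCech X) (hy : y ∈ W) => hy
    have hGc : Continuous fun y : W => h y.1 y.1 := by
      rw [continuous_iff_continuousAt]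
      intro y
      have : (fun w : W => h w.1 w.1) =ᶠ[nhds y] fun w : W => h y.1 w.1 := by
        filter_upwards [((hgood y.1 y.2).1.preimage continuous_subtype_val).mem_nhds (hmem y.1 y.2)]
          with w hw
        exact huniq _ _ _ _ (hgood w.1 w.2) (hgood y.1 y.2) w.1 ⟨hmem w.1 w.2, hw⟩
      exact ContinuousAt.congr ((h y.1).continuous.comp continuous_subtype_val).continuousAt
        this.symm
    refine ⟨LimitRing.mk ⟨W, hWo, hWd⟩ ⟨_, hGc⟩, ?_⟩
    rw [restrictQ, LimitRing.pullback_mk]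
    let i' : Stage (denseOpen X) := ⟨V, hVo, hVd⟩
    let j' : Stage (denseOpen X) :=
      ⟨stoneCechUnit ⁻¹' W, preimage_mem_denseOpen _ ⟨hWo, hWd⟩⟩
    have hji : j' ≤ i' := fun z hz => hVW ⟨z, hz⟩
    rw [← LimitRing.mk_res hji]
    refine congrArg _ (ContinuousMap.ext fun z => ?_)
    exact (hgood _ (hVW z)).2 z (hmem _ (hVW z))

variable (X)

/-- The embedding `Q(X) = Q(βX) ⊂ Q̄(X)`. -/
def toQbar [T35Space X] : Q X →+* Qbar X :=
  (inclQ X).comp (RingEquiv.ofBijective (restrictQ X) restrictQ_bijective).symm.toRingHom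

variable {X}

theorem monotone_toQbar [T35Space X] : Monotone (toQbar X) := by
  intro a b h
  refine LimitRing.monotone_pullback _ _ _ ?_
  rw [← restrictQ_le_iff]
  have key (c : Q X) : restrictQ X ((RingEquiv.ofBijective (restrictQ X)
      restrictQ_bijective).symm c) = c :=
    (RingEquiv.ofBijective (restrictQ X) restrictQ_bijective).apply_symm_apply c
  exact (key a).le.trans (h.trans (key b).ge)

variable (X)

/-- The embedding `C(X) ⊂ Q(X) ⊂ Q̄(X)`. -/
def continuousToQbar [T35Space X] : C(X, ℝ) →+* Qbar X :=
  (toQbar X).comp LimitRing.ofContinuous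

/-- `Q_L(X)`: elements of `Q(X)` represented by a locally constant function on a dense open set. -/
def QL : Subring (Q X) :=
  LimitRing.subringOf
    (fun _ =>
      { carrier := {f | IsLocallyConstant f}
        one_mem' := IsLocallyConstant.const 1
        zero_mem' := IsLocallyConstant.const 0
        mul_mem' := fun hf hg => IsLocallyConstant.mul hf hg
        add_mem' := fun hf hg => IsLocallyConstant.add hf hg
        neg_mem' := fun hf => IsLocallyConstant.neg hf })
    fun i _ h f (hf : IsLocallyConstant f) =>
      (hf.comp_continuous (continuous_inclusion h) :)

/-- `Q_F(X)`: elements of `Q(X)` represented by a continuous function with finite range on a dense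
open set. -/
def QF : Subring (Q X) :=
  LimitRing.subringOf
    (fun i =>
      { carrier := {f | (Set.range f).Finite}
        one_mem' := (Set.finite_singleton (1 : ℝ)).subset (by rintro _ ⟨x, rfl⟩; rfl)
        zero_mem' := (Set.finite_singleton (0 : ℝ)).subset (by rintro _ ⟨x, rfl⟩; rfl)
        mul_mem' := fun hf hg => (Set.Finite.image2 (· * ·) hf hg).subset (by
          rintro _ ⟨x, rfl⟩; exact ⟨_, ⟨x, rfl⟩, _, ⟨x, rfl⟩, rfl⟩)
        add_mem' := fun hf hg => (Set.Finite.image2 (· + ·) hf hg).subset (by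
          rintro _ ⟨x, rfl⟩; exact ⟨_, ⟨x, rfl⟩, _, ⟨x, rfl⟩, rfl⟩)
        neg_mem' := fun hf => (Set.Finite.image (- ·) hf).subset (by
          rintro _ ⟨x, rfl⟩; exact ⟨_, ⟨x, rfl⟩, rfl⟩) })
    fun i j h f hf => Set.Finite.subset hf (by rintro _ ⟨x, rfl⟩; exact ⟨_, rfl⟩)

/-- `Q*(X)`: the bounded elements of `Q(X)`. -/
abbrev Qstar : Subring (Q X) := boundedElements (Q X)

/-- `Q̄*(X)`: the bounded elements of `Q̄(X)`. -/
abbrev QbarStar : Subring (Qbar X) := boundedElements (Qbar X)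

/-- `C*(X)`: the bounded elements of `C(X)`. -/
abbrev CStar : Subring C(X, ℝ) := boundedElements C(X, ℝ)

/-- The ring of `C`-bounded elements of `Q̄(X)`: those `h` with `|h| ≤ g` for some `g` in `C(X)`. -/
def CBounded [T35Space X] : Subring (Qbar X) where
  carrier := {h | ∃ g : C(X, ℝ), |h| ≤ continuousToQbar X g}
  one_mem' := ⟨1, by
    rw [map_one]; exact abs_le'.2 ⟨le_rfl, (neg_nonpos.2 zero_le_one).trans zero_le_one⟩⟩
  zero_mem' := ⟨0, by rw [map_zero]; exact abs_le'.2 ⟨le_rfl, by simp⟩⟩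
  add_mem' := by
    rintro a b ⟨g, ha⟩ ⟨k, hb⟩
    refine ⟨g + k, ?_⟩
    rw [abs_le'] at ha hb ⊢
    rw [map_add, neg_add]
    exact ⟨add_le_add ha.1 hb.1, add_le_add ha.2 hb.2⟩
  neg_mem' := by
    rintro a ⟨g, ha⟩
    exact ⟨g, by rwa [abs_neg]⟩
  mul_mem' := by
    rintro a b ⟨g, ha⟩ ⟨k, hb⟩
    refine ⟨3 * (g * k), ?_⟩
    have hg := (abs_nonneg a).trans ha
    have hk := (abs_nonneg b).trans hb
    rw [abs_le'] at ha hb ⊢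
    have h := mul_mem_bounds (neg_le.1 ha.2) ha.1 (neg_le.1 hb.2) hb.1 hg hk
    rw [map_mul, map_mul, map_ofNat]
    exact ⟨h.2, neg_le.1 h.1⟩

variable {X}

theorem monotone_continuousToQbar [T35Space X] : Monotone (continuousToQbar X) :=
  fun _ _ h => monotone_toQbar (LimitRing.monotone_ofContinuous h)

theorem QF_le_Qstar : QF X ≤ Qstar X := by
  rintro _ ⟨i, f, hf, rfl⟩
  obtain ⟨M, hM⟩ := hf.bddAbove
  obtain ⟨N, hN⟩ := hf.bddBelow
  obtain ⟨m, hm⟩ := exists_nat_ge (max M (-N))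
  rw [max_le_iff] at hm
  refine ⟨m, ?_, ?_⟩
  · rw [← LimitRing.mk_natCast i, LimitRing.mk_neg, LimitRing.mk_le_mk]
    intro x
    have := hN ⟨x, rfl⟩
    have h2 : (-(m : C(i.carrier, ℝ))) x = -(m : ℝ) := by simp
    change (-(m : C(i.carrier, ℝ))) x ≤ f x
    rw [h2]; linarith [hm.2]
  · rw [← LimitRing.mk_natCast i, LimitRing.mk_le_mk]
    intro x
    have := hM ⟨x, rfl⟩
    have h2 : (m : C(i.carrier, ℝ)) x = (m : ℝ) := by simp
    change f x ≤ (m : C(i.carrier, ℝ)) x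
    rw [h2]; linarith [hm.1]

theorem continuousToQbar_mem_CBounded [T35Space X] (f : C(X, ℝ)) :
    continuousToQbar X f ∈ CBounded X :=
  ⟨|f|, abs_le'.2 ⟨monotone_continuousToQbar (le_abs_self f), by
    rw [← map_neg]; exact monotone_continuousToQbar (neg_le_abs f)⟩⟩

variable (X)

/-- The embedding `Q_L(X) ⊂ Q̄(X)`. -/
def qlToQbar [T35Space X] : QL X →+* Qbar X := (toQbar X).comp (QL X).subtype

/-- The embedding `Q*(X) ⊂ Q̄*(X)`. -/
def qstarToQbarStar [T35Space X] : Qstar X →+* QbarStar X :=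
  (toQbar X).restrict (Qstar X) (QbarStar X) (map_boundedElements _ monotone_toQbar)

/-- The embedding `Q_F(X) ⊂ Q̄*(X)`. -/
def qfToQbarStar [T35Space X] : QF X →+* QbarStar X :=
  (qstarToQbarStar X).comp (Subring.inclusion QF_le_Qstar)

/-- The embedding of `C(X)` in the ring of `C`-bounded elements of `Q̄(X)`. -/
def continuousToCBounded [T35Space X] : C(X, ℝ) →+* CBounded X :=
  (continuousToQbar X).codRestrict (CBounded X) continuousToQbar_mem_CBounded

/-- The embedding `C*(X) ⊂ Q̄*(X)`. -/
def cstarToQbarStar [T35Space X] : CStar X →+* QbarStar X :=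
  (continuousToQbar X).restrict (CStar X) (QbarStar X)
    (map_boundedElements _ monotone_continuousToQbar)

end

/-! ### Completions -/

/-- `φ : A → B` exhibits `B` as the Dedekind completion of `A`: it is an embedding of ordered
rings, every nonempty subset of `B` with an upper bound has a supremum, and every element of `B`
is the supremum of a set of elements of `A`. -/
structure IsDedekindCompletion {A B : Type u} [CommRing A] [PartialOrder A] [CommRing B]
    [PartialOrder B] (φ : A →+* B) : Prop where
  le_iff : ∀ a a' : A, φ a ≤ φ a' ↔ a ≤ a'
  exists_isLUB : ∀ P : Set B, P.Nonempty → BddAbove P → ∃ s, IsLUB P s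
  isLUB_image : ∀ b : B, ∃ P : Set A, IsLUB (φ '' P) b

/-- `φ : A → B` exhibits `B` as the metric completion of `A`. -/
structure IsMetricCompletion {A B : Type u} [MetricSpace A] [MetricSpace B] (φ : A → B) :
    Prop where
  isometry : Isometry φ
  denseRange : DenseRange φ
  complete : CompleteSpace B

/-- `φ : A → B` exhibits `B` as a ring of quotients of its subring `A`: for all `b` and `b' ≠ 0` in
`B` there is `a` in `A` such that `b a ∈ A` and `b' a ≠ 0`. -/
structure IsRingOfQuotients {A B : Type u} [CommRing A] [CommRing B] (φ : A →+* B) : Prop where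
  injective : Function.Injective φ
  exists_mul : ∀ b b' : B, b' ≠ 0 → ∃ a : A, b * φ a ∈ φ.range ∧ b' * φ a ≠ 0

/-- `φ : A → B` exhibits `B` as the maximal (largest) ring of quotients of `A`. -/
structure IsMaximalRingOfQuotients {A B : Type u} [CommRing A] [CommRing B] (φ : A →+* B) :
    Prop where
  isRingOfQuotients : IsRingOfQuotients φ
  exists_embedding : ∀ (B' : Type u) [CommRing B'] (ψ : A →+* B'), IsRingOfQuotients ψ →
    ∃ θ : B' →+* B, Function.Injective θ ∧ θ.comp ψ = φ

end

end RingsOfFunctions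

/-! Since restriction identifies `Q(βX)` with `Q(X)`, all comparisons with `Q̄(X)` take place on the
Baire space `βX`.

Dedekind completeness of `Q̄(X)` (`exists_isLUB_denseGdelta`): for a bounded set `P`, let `U q` be
the union of the open sets on which some member of `P` exceeds `q`. The supremum is `y ↦ sup {q | y
∈ U q}`. It is continuous off the frontiers of the `U q` with `q` rational, and these are countably
many closed nowhere dense sets. So a dense `G_δ` domain remains even when `P` is uncountable.

Order density (`HasBumps.exists_le_not_le`): if `b ≰ v`, there are a real `r` and a nonempty open
`O` with `v < r < b` on `O`. For a bump `e` supported in `O` and any `g ≤ b` from the subring, `(1 -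
e) g + e r` is below `b` but not below `v`. Hence `b` is the supremum of the elements of the subring
below it, as soon as there is one. Constants and bumps lie in all six subrings: indicators of open
sets for those containing `Q_F(X)`, cut-off functions on `βX` for `C(X)` and `C*(X)`.
`HasBumps.isDedekindCompletion` then gives the six completions.

Metric completion: functions on dense sets are uniform limits of locally constant functions on dense
open sets, so `Q(X)` is dense. A Cauchy sequence has a common domain because a countable
intersection of dense `G_δ` sets is dense.

Maximal quotients: an element `b` of a ring of quotients of `C(X)` is determined by the pairs `(a,
c)` with `b a = c`. The fractions `c / a` agree where they overlap and glue to a continuous function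
on the union of the cozero sets of the `a`, which is dense because no nonzero function annihilates
every `a`. -/

namespace RingsOfFunctions

universe u

noncomputable section

open Topology

/-! ### Pointwise comparison of representatives -/

section

variable {Y : Type u} [TopologicalSpace Y]

/-- A continuous function on a subset `S` takes values in an open set on the trace of an open
neighbourhood of each point that it maps there. -/
theorem exists_isOpen_forall_mem {S : Set Y} (f : C(S, ℝ)) {P : Set ℝ} (hP : IsOpen P) (y : S)
    (hy : f y ∈ P) : ∃ O : Set Y, IsOpen O ∧ y.1 ∈ O ∧ ∀ z : S, z.1 ∈ O → f z ∈ P := by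
  obtain ⟨O, hO, h⟩ := isOpen_induced_iff.1 (hP.preimage f.continuous)
  refine ⟨O, hO, ?_, fun z hz => ?_⟩
  · change y ∈ Subtype.val ⁻¹' O
    rw [h]; exact hy
  · have : z ∈ Subtype.val ⁻¹' O := hz
    rw [h] at this; exact this

namespace LimitRing

variable {𝓢 : DenseFilterBase Y}

theorem exists_eq_mk (a : LimitRing 𝓢) : ∃ i f, a = mk i f :=
  ind (p := fun a => ∃ i f, a = mk i f) (fun i f => ⟨i, f, rfl⟩) a

theorem mk_sub (i : Stage 𝓢) (f g) : mk i f - mk i g = mk i (f - g) := by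
  rw [sub_eq_add_neg, mk_neg, mk_add, sub_eq_add_neg]

/-- The intersection of two stages. -/
def stageInter (i j : Stage 𝓢) : Stage 𝓢 := ⟨i.carrier ∩ j.carrier, 𝓢.inter_mem i.mem j.mem⟩

theorem le_stageInter_left (i j : Stage 𝓢) : i ≤ stageInter i j :=
  (Set.inter_subset_left : i.carrier ∩ j.carrier ⊆ _)

theorem le_stageInter_right (i j : Stage 𝓢) : j ≤ stageInter i j :=
  (Set.inter_subset_right : i.carrier ∩ j.carrier ⊆ _)

theorem mk_le_mk_iff {i j : Stage 𝓢} {f : C(i.carrier, ℝ)} {g : C(j.carrier, ℝ)} :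
    mk i f ≤ mk j g ↔ ∀ y (hi : y ∈ i.carrier) (hj : y ∈ j.carrier), f ⟨y, hi⟩ ≤ g ⟨y, hj⟩ := by
  rw [← mk_res (le_stageInter_left i j) f, ← mk_res (le_stageInter_right i j) g, mk_le_mk]
  exact ⟨fun h y hi hj => h ⟨y, hi, hj⟩, fun h y => h y.1 y.2.1 y.2.2⟩

theorem mk_eq_mk_iff {i j : Stage 𝓢} {f : C(i.carrier, ℝ)} {g : C(j.carrier, ℝ)} :
    mk i f = mk j g ↔ ∀ y (hi : y ∈ i.carrier) (hj : y ∈ j.carrier), f ⟨y, hi⟩ = g ⟨y, hj⟩ := by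
  simp only [le_antisymm_iff, mk_le_mk_iff]
  exact ⟨fun h y hi hj => ⟨h.1 y hi hj, h.2 y hj hi⟩,
    fun h => ⟨fun y hi hj => (h y hi hj).1, fun y hj hi => (h y hi hj).2⟩⟩

/-- Strict inequality at one point forces strict inequality on a nonempty open set. -/
theorem exists_isOpen_lt_of_not_le {i j : Stage 𝓢} {f : C(i.carrier, ℝ)} {g : C(j.carrier, ℝ)}
    (h : ¬ mk i f ≤ mk j g) : ∃ (r : ℝ) (O : Set Y), IsOpen O ∧ O.Nonempty ∧
      (∀ z : i.carrier, z.1 ∈ O → r < f z) ∧ ∀ z : j.carrier, z.1 ∈ O → g z < r := by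
  rw [mk_le_mk_iff] at h
  push Not at h
  obtain ⟨y, hi, hj, hlt⟩ := h
  obtain ⟨r, hr, hr'⟩ := exists_between hlt
  obtain ⟨O, hO, hyO, h1⟩ := exists_isOpen_forall_mem f isOpen_Ioi ⟨y, hi⟩ hr'
  obtain ⟨O', hO', hyO', h2⟩ := exists_isOpen_forall_mem g isOpen_Iio ⟨y, hj⟩ hr
  exact ⟨r, O ∩ O', hO.inter hO', ⟨y, hyO, hyO'⟩, fun z hz => h1 z hz.1, fun z hz => h2 z hz.2⟩

/-- The supremum of a continuous function is unchanged by passing to a dense set of points. -/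
theorem isometry_pullback {X : Type u} [TopologicalSpace X] {𝓣 : DenseFilterBase X} (ι : X → Y)
    (hc : Continuous ι) (h : ∀ S ∈ 𝓢.sets, ι ⁻¹' S ∈ 𝓣.sets)
    (hd : ∀ i : Stage 𝓢, DenseRange (i.carrier.restrictPreimage ι)) :
    Isometry (pullback (𝓣 := 𝓣) ι hc h) := by
  refine Isometry.of_dist_eq fun a b => ?_
  induction a, b using ind₂ with | h i f g => ?_
  rw [pullback_mk, pullback_mk, dist_mk, dist_mk]
  apply le_antisymm
  · exact stageDist_le _ _ _ (stageDist_nonneg _ _ _) fun x =>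
      le_stageDist i f g (i.carrier.restrictPreimage ι x)
  · refine stageDist_le _ _ _ (stageDist_nonneg _ _ _) fun x => ?_
    refine (hd i).induction_on (p := fun x => |f x - g x| / (1 + |f x - g x|) ≤ _) x ?_
      fun a => le_stageDist ⟨ι ⁻¹' i.carrier, h _ i.mem⟩
        (f.comp ⟨i.carrier.restrictPreimage ι, hc.restrictPreimage⟩)
        (g.comp ⟨i.carrier.restrictPreimage ι, hc.restrictPreimage⟩) a
    refine isClosed_le (Continuous.div (by fun_prop) (by fun_prop) fun x => ?_) continuous_const
    positivity

/-- The constant function with value `r`, as an element of `C[𝓢]`. -/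
def const (r : ℝ) : LimitRing 𝓢 := ofContinuous (ContinuousMap.const Y r)

theorem const_eq_mk (i : Stage 𝓢) (r : ℝ) : const r = mk i (ContinuousMap.const _ r) :=
  mk_eq_mk_iff.2 fun _ _ _ => rfl

theorem const_neg (r : ℝ) : (const (-r) : LimitRing 𝓢) = -const r :=
  map_neg ofContinuous (ContinuousMap.const Y r)

theorem const_natCast (m : ℕ) : (const (m : ℝ) : LimitRing 𝓢) = m := by
  have h : ContinuousMap.const Y (m : ℝ) = (m : C(Y, ℝ)) := by ext; simp
  exact (congrArg ofContinuous h).trans (map_natCast _ m)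

theorem ofContinuous_eq_mk (i : Stage 𝓢) (f : C(Y, ℝ)) :
    ofContinuous f = mk i (f.comp ⟨Subtype.val, continuous_subtype_val⟩) :=
  mk_eq_mk_iff.2 fun _ _ _ => rfl

theorem ofContinuous_le_ofContinuous {f g : C(Y, ℝ)} :
    (ofContinuous f : LimitRing 𝓢) ≤ ofContinuous g ↔ f ≤ g :=
  mk_le_mk.trans ⟨fun h x => h ⟨x, trivial⟩, fun h x => h x⟩

theorem ofContinuous_injective : Function.Injective (ofContinuous : C(Y, ℝ) →+* LimitRing 𝓢) :=
  fun _ _ h => le_antisymm (ofContinuous_le_ofContinuous.1 h.le)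
    (ofContinuous_le_ofContinuous.1 h.ge)

theorem mk_mul_mk (i j : Stage 𝓢) (f g) :
    mk i f * mk j g = mk (stageInter i j) (res i _ (le_stageInter_left i j) f *
      res j _ (le_stageInter_right i j) g) := by
  rw [← mk_mul, mk_res, mk_res]

end LimitRing

end

/-! ### Cuts and suprema -/

section

open LimitRing

variable {K : Type u} [TopologicalSpace K] [BaireSpace K]

/-- A decreasing family of open sets `U q` which is locally proper on a dense `G_δ` set defines a
continuous function `y ↦ sup {q | y ∈ U q}` on a dense `G_δ` set. -/
theorem exists_continuous_of_cut (U : ℝ → Set K) (hU : ∀ q, IsOpen (U q)) (hanti : Antitone U)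
    {D : Set K} (hD : D ∈ (denseGdelta K).sets) (hlo : ∀ y ∈ D, ∃ q, y ∈ U q)
    (hhi : ∀ y ∈ D, ∃ q, y ∉ U q) :
    ∃ (i : Stage (denseGdelta K)) (F : C(i.carrier, ℝ)), i.carrier ⊆ D ∧
      ∀ (y : i.carrier) (q : ℝ), (q < F y → y.1 ∈ U q) ∧ (y.1 ∈ U q → q ≤ F y) := by
  -- Rational levels suffice for continuity and keep the intersection countable. The frontier of an
  -- open set is closed and nowhere dense, so `E` is a dense `G_δ` by Baire.
  let E : Set K := ⋂ q : ℚ, (frontier (U q))ᶜ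
  have ho : ∀ q : ℚ, IsOpen (frontier (U q))ᶜ := fun q => isClosed_frontier.isOpen_compl
  have hE : E ∈ (denseGdelta K).sets := by
    refine ⟨IsGδ.iInter_of_isOpen ho, dense_iInter_of_isOpen ho fun q => ?_⟩
    rw [← interior_eq_empty_iff_dense_compl, ← frontier_compl]
    exact interior_frontier (hU q).isClosed_compl
  have hbdd : ∀ y ∈ D, BddAbove {q | y ∈ U q} := fun y hy => by
    obtain ⟨q, hq⟩ := hhi y hy
    refine ⟨q, fun r hr => ?_⟩
    by_contra hlt
    exact hq (hanti (not_le.1 hlt).le hr)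
  let F : ↑(D ∩ E) → ℝ := fun y => sSup {q | y.1 ∈ U q}
  have h1 : ∀ (y : ↑(D ∩ E)) (q : ℝ), q < F y → y.1 ∈ U q := fun y q hq => by
    obtain ⟨r, hr, hqr⟩ := exists_lt_of_lt_csSup (hlo y.1 y.2.1) hq
    exact hanti hqr.le hr
  have h2 : ∀ (y : ↑(D ∩ E)) (q : ℝ), y.1 ∈ U q → q ≤ F y := fun y q hq =>
    le_csSup (hbdd y.1 y.2.1) hq
  have hF : Continuous F := by
    rw [continuous_iff_continuousAt]
    intro y
    refine tendsto_order.2 ⟨fun c hc => ?_, fun c hc => ?_⟩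
    · obtain ⟨q, hcq, hq⟩ := exists_between hc
      filter_upwards [((hU q).preimage continuous_subtype_val).mem_nhds (h1 y q hq)] with z hz
      exact hcq.trans_le (h2 z q hz)
    -- Lower semicontinuity used only that the `U q` are open; here the point must be off the
    -- closure of `U q`, which membership in `E` supplies for rational `q`.
    · obtain ⟨q, hq, hqc⟩ := exists_rat_btwn hc
      have hy : y.1 ∉ U q := fun h => hq.not_ge (h2 y q h)
      have hy' : y.1 ∉ closure (U q) := fun h =>
        Set.mem_iInter.1 y.2.2 q ⟨h, by rwa [(hU q).interior_eq]⟩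
      filter_upwards [(isClosed_closure.isOpen_compl.preimage continuous_subtype_val).mem_nhds hy']
        with z hz
      refine lt_of_le_of_lt (not_lt.1 fun h => hz (subset_closure (h1 z q h))) hqc
  exact ⟨⟨D ∩ E, (denseGdelta K).inter_mem hD hE⟩, ⟨F, hF⟩, Set.inter_subset_left,
    fun y q => ⟨h1 y q, h2 y q⟩⟩

/-- Continuous functions on dense `G_δ` subsets of a Baire space form a Dedekind complete
ordered set. -/
theorem exists_isLUB_denseGdelta (P : Set (LimitRing (denseGdelta K))) (hP : P.Nonempty)
    (hb : BddAbove P) : ∃ s, IsLUB P s := by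
  obtain ⟨h₀, hh₀⟩ := hP
  obtain ⟨u, hu⟩ := hb
  obtain ⟨i₀, f₀, rfl⟩ := exists_eq_mk h₀
  obtain ⟨j₀, k₀, rfl⟩ := exists_eq_mk u
  -- The domains of the members of `P` may have no common point, so the supremum is built from open
  -- sets and not from pointwise values.
  let 𝒪 : ℝ → Set (Set K) := fun q => {O | IsOpen O ∧ ∃ i f, mk i f ∈ P ∧
    ∀ z : (i : Stage (denseGdelta K)).carrier, z.1 ∈ O → q < f z}
  let U : ℝ → Set K := fun q => ⋃₀ 𝒪 q
  have hU : ∀ q, IsOpen (U q) := fun q => isOpen_sUnion fun O hO => hO.1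
  have hanti : Antitone U := fun q r hqr => Set.sUnion_subset_sUnion fun O hO => by
    obtain ⟨ho, i, f, hf, h⟩ := hO
    exact ⟨ho, i, f, hf, fun z hz => hqr.trans_lt (h z hz)⟩
  have hlow : ∀ i f, mk i f ∈ P → ∀ (y : i.carrier) (q : ℝ), q < f y → y.1 ∈ U q := by
    intro i f hf y q hq
    obtain ⟨O, hO, hyO, h⟩ := exists_isOpen_forall_mem f isOpen_Ioi y hq
    exact ⟨O, ⟨hO, i, f, hf, h⟩, hyO⟩
  have hupp : ∀ j k, mk j k ∈ upperBounds P → ∀ (y : j.carrier) (q : ℝ), y.1 ∈ U q → q ≤ k y := by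
    rintro j k hk y q ⟨O, ⟨hO, i, f, hf, h⟩, hyO⟩
    by_contra hlt
    obtain ⟨O', hO', hyO', h'⟩ := exists_isOpen_forall_mem k isOpen_Iio y (not_le.1 hlt)
    obtain ⟨z, hz, hzO⟩ := ((denseGdelta K).dense (stageInter i j).mem).inter_open_nonempty _
      (hO.inter hO') ⟨y.1, hyO, hyO'⟩
    exact lt_asymm (h ⟨z, hzO.1⟩ hz.1)
      ((mk_le_mk_iff.1 (hk hf) z hzO.1 hzO.2).trans_lt (h' ⟨z, hzO.2⟩ hz.2))
  -- The cut is proper wherever a single member `f₀` and a single upper bound `k₀` are both defined.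
  obtain ⟨i, F, hi, hF⟩ := exists_continuous_of_cut U hU hanti (stageInter i₀ j₀).mem
    (fun y hy => ⟨_, hlow i₀ f₀ hh₀ ⟨y, hy.1⟩ _ (sub_one_lt _)⟩)
    (fun y hy => ⟨k₀ ⟨y, hy.2⟩ + 1, fun h => by linarith [hupp j₀ k₀ hu ⟨y, hy.2⟩ _ h]⟩)
  refine ⟨mk i F, fun h hh => ?_, fun v hv => ?_⟩
  · obtain ⟨j, f, rfl⟩ := exists_eq_mk h
    rw [mk_le_mk_iff]
    exact fun y hj hi => le_of_forall_lt_imp_le_of_dense fun q hq =>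
      (hF ⟨y, hi⟩ q).2 (hlow j f hh ⟨y, hj⟩ q hq)
  · obtain ⟨j, k, rfl⟩ := exists_eq_mk v
    rw [mk_le_mk_iff]
    exact fun y hi hj => le_of_forall_lt_imp_le_of_dense fun q hq =>
      hupp j k hv ⟨y, hj⟩ q ((hF ⟨y, hi⟩ q).1 hq)

end

/-! ### Approximation by locally constant functions -/

section

open LimitRing

/-- In a family of open sets that is closed under shrinking and has dense union, there is a
disjoint family with dense union. -/
theorem exists_pairwiseDisjoint_dense_sUnion {K : Type u} [TopologicalSpace K] (𝒪 : Set (Set K))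
    (hsub : ∀ O ∈ 𝒪, ∀ O' ⊆ O, IsOpen O' → O' ∈ 𝒪) (hopen : ∀ O ∈ 𝒪, IsOpen O)
    (hd : Dense (⋃₀ 𝒪)) : ∃ 𝓕 ⊆ 𝒪, 𝓕.PairwiseDisjoint id ∧ Dense (⋃₀ 𝓕) := by
  obtain ⟨𝓕, h𝓕⟩ := zorn_subset {𝓕 : Set (Set K) | 𝓕 ⊆ 𝒪 ∧ 𝓕.PairwiseDisjoint id}
    fun c hc hchain => ⟨⋃₀ c, ⟨Set.sUnion_subset fun s hs => (hc hs).1,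
      (Set.pairwiseDisjoint_sUnion hchain.directedOn).2 fun s hs => (hc hs).2⟩,
      fun s hs => Set.subset_sUnion_of_mem hs⟩
  refine ⟨𝓕, h𝓕.prop.1, h𝓕.prop.2, ?_⟩
  rw [dense_iff_inter_open]
  intro V hV hne
  obtain ⟨y, hyV, O, hO, hyO⟩ := hd.inter_open_nonempty V hV hne
  by_contra hemp
  have hdisj : ∀ W ∈ 𝓕, Disjoint (V ∩ O) W := fun W hW => by
    rw [Set.disjoint_left]
    exact fun z hz hzW => hemp ⟨z, hz.1, W, hW, hzW⟩
  -- `V ∩ O` is disjoint from every member of `𝓕`, so by maximality it already belongs to `𝓕`; yet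
  -- it contains `y`, which lies in `V`.
  have hmem : V ∩ O ∈ 𝓕 := by
    refine h𝓕.le_of_ge (y := insert (V ∩ O) 𝓕) ⟨Set.insert_subset
      (hsub O hO _ Set.inter_subset_right (hV.inter (hopen O hO))) h𝓕.prop.1,
      h𝓕.prop.2.insert fun W hW _ => hdisj W hW⟩ (Set.subset_insert _ _) (Set.mem_insert _ _)
  exact hemp ⟨y, hyV, _, hmem, hyV, hyO⟩

/-- A continuous function on a dense set is uniformly approximated by locally constant functions
on dense open sets. -/
theorem exists_isLocallyConstant_approx {K : Type u} [TopologicalSpace K] {𝓢 : DenseFilterBase K}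
    (i : Stage 𝓢) (f : C(i.carrier, ℝ)) {ε : ℝ} (hε : 0 < ε) :
    ∃ (j : Stage (denseOpen K)) (g : C(j.carrier, ℝ)), IsLocallyConstant g ∧
      ∀ y (hi : y ∈ i.carrier) (hj : y ∈ j.carrier), |f ⟨y, hi⟩ - g ⟨y, hj⟩| ≤ ε := by
  let 𝒪 : Set (Set K) :=
    {O | IsOpen O ∧ ∃ c : ℝ, ∀ z : i.carrier, z.1 ∈ O → |f z - c| ≤ ε}
  obtain ⟨𝓕, h𝓕, hdisj, hd⟩ := exists_pairwiseDisjoint_dense_sUnion 𝒪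
    (fun O hO O' h ho => ⟨ho, hO.2.imp fun c hc z hz => hc z (h hz)⟩) (fun O hO => hO.1) <| by
      refine (𝓢.dense i.mem).mono fun y hy => ?_
      obtain ⟨O, hO, hyO, h⟩ := exists_isOpen_forall_mem f
        (Metric.isOpen_ball (x := f ⟨y, hy⟩) (ε := ε)) ⟨y, hy⟩ (Metric.mem_ball_self hε)
      exact ⟨O, ⟨hO, f ⟨y, hy⟩, fun z hz => (h z hz).le⟩, hyO⟩
  choose! c hc using fun O (hO : O ∈ 𝓕) => (h𝓕 hO).2
  -- By disjointness `T y` is the only member of `𝓕` containing `y`, so `c ∘ T` is constant on each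
  -- member.
  choose! T hT hmem using fun y (hy : y ∈ ⋃₀ 𝓕) => hy
  have hopen : IsOpen (⋃₀ 𝓕) := isOpen_sUnion fun O hO => (h𝓕 hO).1
  let g : ↑(⋃₀ 𝓕) → ℝ := fun y => c (T y.1)
  have hg : IsLocallyConstant g := by
    rw [IsLocallyConstant.iff_exists_open]
    intro y
    refine ⟨Subtype.val ⁻¹' T y.1, (h𝓕 (hT y.1 y.2)).1.preimage continuous_subtype_val,
      hmem y.1 y.2, fun z hz => congrArg c ?_⟩
    exact hdisj.elim_set (hT z.1 z.2) (hT y.1 y.2) z.1 (hmem z.1 z.2) hz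
  exact ⟨⟨⋃₀ 𝓕, hopen, hd⟩, ⟨g, hg.continuous⟩, hg, fun y hi hj =>
    hc _ (hT y hj) ⟨y, hi⟩ (hmem y hj)⟩

theorem ratio_le_self (t : ℝ) : |t| / (1 + |t|) ≤ |t| :=
  div_le_self (abs_nonneg t) (by linarith [abs_nonneg t])

/-- Inverts the increasing map `s ↦ s / (1 + s)`, turning closeness in the metric into uniform
closeness. -/
theorem abs_le_of_ratio_le {t c : ℝ} (hc : c < 1) (h : |t| / (1 + |t|) ≤ c) :
    |t| ≤ c / (1 - c) := by
  have h0 := abs_nonneg t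
  rw [div_le_iff₀ (by linarith)] at h
  rw [le_div_iff₀ (by linarith)]
  linarith

end

/-! ### Metric completeness -/

section

open LimitRing Filter

variable {K : Type u} [TopologicalSpace K] [BaireSpace K]

theorem completeSpace_denseGdelta : CompleteSpace (LimitRing (denseGdelta K)) := by
  refine UniformSpace.complete_of_cauchySeq_tendsto fun a ha => ?_
  choose i f hf using fun n => exists_eq_mk (a n)
  -- By Baire the whole sequence lives on one dense `G_δ` set; dense open sets would not be closed
  -- under this countable intersection.
  let j : Stage (denseGdelta K) := ⟨⋂ n, (i n).carrier, IsGδ.iInter fun n => (i n).mem.1,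
    dense_iInter_of_Gδ (fun n => (i n).mem.1) fun n => (i n).mem.2⟩
  have hij : ∀ n, i n ≤ j := fun n => Set.iInter_subset (fun n => (i n).carrier) n
  let g : ℕ → C(j.carrier, ℝ) := fun n => res (i n) j (hij n) (f n)
  have hg : ∀ n, a n = mk j (g n) := fun n => by rw [hf, mk_res]
  have hunif : ∀ ε > 0, ∃ N, ∀ m ≥ N, ∀ n ≥ N, ∀ x, |g m x - g n x| ≤ ε := by
    intro ε hε
    obtain ⟨N, hN⟩ := Metric.cauchySeq_iff.1 ha (ε / (1 + ε)) (by positivity)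
    refine ⟨N, fun m hm n hn x => ?_⟩
    have h := hN m hm n hn
    rw [hg, hg, dist_mk] at h
    have hlt : ε / (1 + ε) < 1 := by rw [div_lt_one (by positivity)]; linarith
    refine (abs_le_of_ratio_le hlt ((le_stageDist j (g m) (g n) x).trans h.le)).trans_eq ?_
    field_simp
    ring
  have hcauchy : ∀ x, CauchySeq fun n => g n x := fun x => by
    refine Metric.cauchySeq_iff.2 fun ε hε => ?_
    obtain ⟨N, hN⟩ := hunif (ε / 2) (by positivity)
    exact ⟨N, fun m hm n hn => (hN m hm n hn x).trans_lt (by linarith)⟩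
  choose F hF using fun x => cauchySeq_tendsto_of_complete (hcauchy x)
  have hlim : ∀ ε > 0, ∃ N, ∀ n ≥ N, ∀ x, |F x - g n x| ≤ ε := by
    intro ε hε
    obtain ⟨N, hN⟩ := hunif ε hε
    refine ⟨N, fun n hn x => le_of_tendsto ((hF x).sub_const (g n x)).abs ?_⟩
    filter_upwards [eventually_ge_atTop N] with m hm using hN m hm n hn x
  have hFc : Continuous F := by
    refine TendstoUniformly.continuous (F := fun n => ⇑(g n)) (p := atTop) ?_
      (Frequently.of_forall fun n => (g n).continuous)
    refine Metric.tendstoUniformly_iff.2 fun ε hε => ?_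
    obtain ⟨N, hN⟩ := hlim (ε / 2) (by positivity)
    filter_upwards [eventually_ge_atTop N] with n hn x
    exact (hN n hn x).trans_lt (by linarith)
  refine ⟨mk j ⟨F, hFc⟩, Metric.tendsto_atTop.2 fun ε hε => ?_⟩
  obtain ⟨N, hN⟩ := hlim (ε / 2) (by positivity)
  refine ⟨N, fun n hn => lt_of_le_of_lt ?_ (half_lt_self hε)⟩
  rw [hg, dist_comm, dist_mk]
  exact stageDist_le _ _ _ (by positivity) fun x => (ratio_le_self _).trans (hN n hn x)

end

/-! ### Bumps and indicators -/

section

open LimitRing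

/-- Doubling and truncating a separating function makes it equal to one on a neighbourhood of `x`
and not merely at `x`. This plateau is what lets the bump dominate the indicator of a nonempty open
set. -/
theorem exists_bump {K : Type u} [TopologicalSpace K] [CompletelyRegularSpace K] {O : Set K}
    (hO : IsOpen O) {x : K} (hx : x ∈ O) : ∃ (e : C(K, ℝ)) (O' : Set K), IsOpen O' ∧ x ∈ O' ∧
      (∀ y, 0 ≤ e y ∧ e y ≤ 1) ∧ (∀ y ∉ O, e y = 0) ∧ ∀ y ∈ O', e y = 1 := by
  obtain ⟨d, hd, hdx, hdO⟩ := CompletelyRegularSpace.completely_regular_isOpen x O hO hx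
  have hd' : Continuous fun y => (d y : ℝ) := continuous_subtype_val.comp hd
  refine ⟨⟨fun y => min 1 (2 * (1 - (d y : ℝ))), by fun_prop⟩, {y | (d y : ℝ) < 1 / 2},
    isOpen_lt hd' continuous_const, ?_, fun y => ⟨?_, min_le_left _ _⟩, fun y hy => ?_,
    fun y hy => ?_⟩
  · change (d x : ℝ) < 1 / 2
    rw [hdx]; norm_num
  · exact le_min zero_le_one (by linarith [(d y).2.2])
  · have : (d y : ℝ) = 1 := by rw [hdO hy]; rfl
    simp [this]
  · have : (d y : ℝ) < 1 / 2 := hy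
    exact min_eq_left (by linarith)

variable {K : Type u} [TopologicalSpace K]

theorem dense_compl_frontier {O : Set K} (hO : IsOpen O) : Dense (frontier O)ᶜ := by
  rw [← interior_eq_empty_iff_dense_compl, ← frontier_compl]
  exact interior_frontier hO.isClosed_compl

theorem isLocallyConstant_indicator {O : Set K} (hO : IsOpen O) :
    IsLocallyConstant fun y : ↑(frontier O)ᶜ => O.indicator (1 : K → ℝ) y.1 := by
  rw [IsLocallyConstant.iff_exists_open]
  intro y
  by_cases hy : y.1 ∈ O
  · exact ⟨Subtype.val ⁻¹' O, hO.preimage continuous_subtype_val, hy, fun z hz => by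
      rw [Set.indicator_of_mem hy, Set.indicator_of_mem (show z.1 ∈ O from hz)]; rfl⟩
  · have hy' : y.1 ∉ closure O := fun h => y.2 ⟨h, by rwa [hO.interior_eq]⟩
    exact ⟨Subtype.val ⁻¹' (closure O)ᶜ,
      isClosed_closure.isOpen_compl.preimage continuous_subtype_val, hy', fun z hz => by
      rw [Set.indicator_of_notMem hy, Set.indicator_of_notMem fun h => hz (subset_closure h)]⟩

/-- The indicator of an open set, as a continuous function off its boundary. -/
def indicatorMap {O : Set K} (hO : IsOpen O) : C(↑(frontier O)ᶜ, ℝ) :=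
  ⟨_, (isLocallyConstant_indicator hO).continuous⟩

theorem indicatorMap_of_mem {O : Set K} (hO : IsOpen O) (y : ↑(frontier O)ᶜ) (hy : y.1 ∈ O) :
    indicatorMap hO y = 1 := Set.indicator_of_mem hy _

theorem indicatorMap_of_notMem {O : Set K} (hO : IsOpen O) (y : ↑(frontier O)ᶜ) (hy : y.1 ∉ O) :
    indicatorMap hO y = 0 := Set.indicator_of_notMem hy _

/-- The indicator of an open set, as an element of `Q(K)`. -/
def indicatorQ {O : Set K} (hO : IsOpen O) : Q K :=
  mk ⟨(frontier O)ᶜ, isClosed_frontier.isOpen_compl, dense_compl_frontier hO⟩ (indicatorMap hO)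

variable [BaireSpace K]

/-- The domain of the indicator of an open set. -/
abbrev indicatorStage {O : Set K} (hO : IsOpen O) : Stage (denseGdelta K) :=
  ⟨(frontier O)ᶜ, isClosed_frontier.isOpen_compl.isGδ, dense_compl_frontier hO⟩

/-- A dense open set, as a dense `G_δ` set. -/
abbrev gdeltaStage (i : Stage (denseOpen K)) : Stage (denseGdelta K) :=
  ⟨i.carrier, i.mem.1.isGδ, i.mem.2⟩

/-- The indicator of an open set, as a continuous function on a dense `G_δ` set. -/
def indicator {O : Set K} (hO : IsOpen O) : LimitRing (denseGdelta K) :=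
  mk (indicatorStage hO) (indicatorMap hO)

theorem indicator_nonneg {O : Set K} (hO : IsOpen O) : 0 ≤ indicator hO := by
  rw [indicator, ← mk_zero, mk_le_mk]
  exact fun y => Set.indicator_nonneg (fun _ _ => zero_le_one) _

theorem indicator_le_one {O : Set K} (hO : IsOpen O) : indicator hO ≤ 1 := by
  rw [indicator, ← mk_one, mk_le_mk]
  exact fun y => Set.indicator_le_self' (fun _ _ => zero_le_one) _

theorem indicator_mul_self {O : Set K} (hO : IsOpen O) :
    indicator hO * indicator hO = indicator hO := by
  rw [indicator, mk_mul]
  refine congrArg _ (ContinuousMap.ext fun y => ?_)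
  by_cases hy : y.1 ∈ O
  · simp [indicatorMap_of_mem hO y hy]
  · simp [indicatorMap_of_notMem hO y hy]

end

/-! ### Order-dense subrings -/

section

open LimitRing

variable {K : Type u} [TopologicalSpace K] [BaireSpace K] {A : Type u} [CommRing A]

/-- A homomorphism into `C[𝒢₀(K)]` has enough bumps when its image contains the constants and,
for every nonempty open set, a function which is between its indicator and the
indicator of some smaller nonempty open set. -/
structure HasBumps (φ : A →+* LimitRing (denseGdelta K)) : Prop where
  exists_const : ∀ r, ∃ c, φ c = const r
  exists_bump : ∀ (O : Set K) (hO : IsOpen O), O.Nonempty → ∃ (e : A) (O' : Set K)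
    (hO' : IsOpen O'), O'.Nonempty ∧ O' ⊆ O ∧ indicator hO' ≤ φ e ∧ φ e ≤ indicator hO

/-- The witness interpolates between the given lower bound `g` and a constant `r` separating `v`
from `b` on an open set `O`: it is `(1 - e) g + e r` with `e` a bump supported in `O`. On the
plateau of `e` it equals `r`, which exceeds `v` there. -/
theorem HasBumps.exists_le_not_le {φ : A →+* LimitRing (denseGdelta K)} (hφ : HasBumps φ)
    {b v : LimitRing (denseGdelta K)} {g : A} (hg : φ g ≤ b) (h : ¬ b ≤ v) :
    ∃ a, φ a ≤ b ∧ ¬ φ a ≤ v := by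
  obtain ⟨i, f, rfl⟩ := exists_eq_mk b
  obtain ⟨j, k, rfl⟩ := exists_eq_mk v
  obtain ⟨r, O, hO, hne, hf, hk⟩ := exists_isOpen_lt_of_not_le h
  obtain ⟨c, hc⟩ := hφ.exists_const r
  obtain ⟨e, O', hO', hne', hsub, he', he⟩ := hφ.exists_bump O hO hne
  have hb : 0 ≤ indicator hO * (LimitRing.mk i f - const r) := by
    rw [const_eq_mk i, mk_sub, indicator, mk_mul_mk, ← mk_zero, mk_le_mk]
    intro x
    change 0 ≤ indicatorMap hO ⟨x.1, x.2.1⟩ * (f ⟨x.1, x.2.2⟩ - r)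
    by_cases hx : x.1 ∈ O
    · rw [indicatorMap_of_mem hO ⟨x.1, x.2.1⟩ hx, one_mul]
      exact (sub_pos.2 (hf ⟨x.1, x.2.2⟩ hx)).le
    · rw [indicatorMap_of_notMem hO ⟨x.1, x.2.1⟩ hx, zero_mul]
  have hv : ¬ indicator hO' * const r ≤ indicator hO' * LimitRing.mk j k := by
    rw [const_eq_mk j, indicator, mk_mul_mk, mk_mul_mk, mk_le_mk]
    intro hle
    obtain ⟨z, hz, hzj⟩ := ((denseGdelta K).dense j.mem).inter_open_nonempty _ hO' hne'
    have hzf : z ∈ (frontier O')ᶜ := fun hz' => hz'.2 (by rwa [hO'.interior_eq])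
    have := hle ⟨z, hzf, hzj⟩
    change indicatorMap hO' ⟨z, hzf⟩ * r ≤ indicatorMap hO' ⟨z, hzf⟩ * k ⟨z, hzj⟩ at this
    rw [indicatorMap_of_mem hO' ⟨z, hzf⟩ hz, one_mul, one_mul] at this
    exact this.not_gt (hk ⟨z, hzj⟩ (hsub hz))
  have he0 : 0 ≤ φ e := (indicator_nonneg hO').trans he'
  have he1 : φ e ≤ 1 := he.trans (indicator_le_one hO)
  -- The support and the plateau of the bump in algebraic form: `e` vanishes off `O` and equals one
  -- on `O'`. The rest is ring computation, without representatives.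
  have hmul : φ e * (1 - indicator hO) = 0 := by
    refine le_antisymm ?_ (mul_nonneg he0 (sub_nonneg.2 (indicator_le_one hO)))
    refine (mul_le_mul_of_nonneg_right he (sub_nonneg.2 (indicator_le_one hO))).trans_eq ?_
    rw [mul_sub, indicator_mul_self, mul_one, sub_self]
  have hmul' : indicator hO' * (1 - φ e) = 0 := by
    refine le_antisymm ?_ (mul_nonneg (indicator_nonneg hO') (sub_nonneg.2 he1))
    refine (mul_le_mul_of_nonneg_left (sub_le_sub_left he' 1) (indicator_nonneg hO')).trans_eq ?_
    rw [mul_sub, indicator_mul_self, mul_one, sub_self]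
  refine ⟨(1 - e) * g + e * c, ?_, fun hle => hv ?_⟩
  · rw [map_add, map_mul, map_mul, map_sub, map_one, hc, ← sub_nonneg]
    have : LimitRing.mk i f - ((1 - φ e) * φ g + φ e * const r) =
        (1 - φ e) * (LimitRing.mk i f - φ g) + φ e * (indicator hO * (LimitRing.mk i f - const r)) := by
      linear_combination (LimitRing.mk i f - const r) * hmul
    rw [this]
    exact add_nonneg (mul_nonneg (sub_nonneg.2 he1) (sub_nonneg.2 hg)) (mul_nonneg he0 hb)
  -- Multiplying by the indicator of `O'` removes `g` and leaves the constant `r`, contradicting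
  -- `hv`.
  · have := mul_le_mul_of_nonneg_left hle (indicator_nonneg hO')
    rw [map_add, map_mul, map_mul, map_sub, map_one, hc] at this
    refine le_of_eq_of_le ?_ this
    linear_combination (const r - φ g) * hmul'

/-- A subring with enough bumps which is coinitial in an order-convex subring has that subring as
its Dedekind completion. -/
theorem HasBumps.isDedekindCompletion {B : Type u} [CommRing B] [PartialOrder B] [PartialOrder A]
    {φ : A →+* B} {ι : B →+* LimitRing (denseGdelta K)} (hφ : HasBumps (ι.comp φ))
    (hι : ∀ b b', ι b ≤ ι b' ↔ b ≤ b')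
    (hconv : ∀ a c : B, ∀ b, ι a ≤ b → b ≤ ι c → b ∈ Set.range ι)
    (hle : ∀ a a', ι (φ a) ≤ ι (φ a') ↔ a ≤ a') (hlow : ∀ b, ∃ a, φ a ≤ b) :
    IsDedekindCompletion φ where
  le_iff a a' := (hι _ _).symm.trans (hle a a')
  exists_isLUB := by
    rintro P ⟨p, hp⟩ ⟨u, hu⟩
    have hmono : Monotone ι := fun b b' h => (hι b b').2 h
    -- The supremum is taken in the full limit ring; lying between a member and an upper bound of
    -- `P`, it falls back into `B` by order convexity.
    obtain ⟨s, hs⟩ := exists_isLUB_denseGdelta (ι '' P) ⟨_, p, hp, rfl⟩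
      (hmono.map_bddAbove ⟨u, hu⟩)
    obtain ⟨t, rfl⟩ := hconv p u s (hs.1 ⟨p, hp, rfl⟩)
      (hs.2 (by rintro _ ⟨q, hq, rfl⟩; exact hmono (hu hq)))
    refine ⟨t, fun q hq => (hι _ _).1 (hs.1 ⟨q, hq, rfl⟩), fun v hv => (hι _ _).1 (hs.2 ?_)⟩
    rintro _ ⟨q, hq, rfl⟩
    exact hmono (hv hq)
  isLUB_image b := by
    refine ⟨{a | φ a ≤ b}, ?_, fun v hv => ?_⟩
    · rintro _ ⟨a, ha, rfl⟩; exact ha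
    · rw [← hι]
      by_contra hlt
      obtain ⟨g, hg⟩ := hlow b
      obtain ⟨a, hab, hav⟩ := hφ.exists_le_not_le ((hι _ _).2 hg) hlt
      exact hav ((hι _ _).2 (hv ⟨a, (hι _ _).1 hab, rfl⟩))

end

/-! ### The embeddings into `Q̄(X)` -/

section

open LimitRing

variable {X : Type u} [TopologicalSpace X]

theorem inclQ_mk (i : Stage (denseOpen (StoneCech X))) (f : C(i.carrier, ℝ)) :
    inclQ X (mk i f) = mk (gdeltaStage i) f := rfl

theorem inclQ_ofContinuous (f : C(StoneCech X, ℝ)) :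
    inclQ X (ofContinuous f) = ofContinuous f := rfl

/-- A finite set of reals is discrete, so a continuous map onto it is locally constant. -/
theorem QF_le_QL : QF X ≤ QL X := by
  rintro _ ⟨i, f, hf, rfl⟩
  have : Finite (Set.range f) := hf
  have hc : Continuous (Set.rangeFactorization f) := f.continuous.subtype_mk _
  exact ⟨i, f, ((IsLocallyConstant.iff_continuous _).2 hc).comp Subtype.val, rfl⟩

theorem mem_QbarStar_of_le_of_le {a b c : Qbar X} (ha : a ∈ QbarStar X) (hc : c ∈ QbarStar X)
    (hab : a ≤ b) (hbc : b ≤ c) : b ∈ QbarStar X := by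
  obtain ⟨m, hm, -⟩ := ha
  obtain ⟨n, -, hn⟩ := hc
  refine ⟨m + n, le_trans ?_ (hm.trans hab), (hbc.trans hn).trans ?_⟩
  · push_cast; exact neg_le_neg (le_add_of_nonneg_right (Nat.cast_nonneg n))
  · push_cast; exact le_add_of_nonneg_left (Nat.cast_nonneg m)

theorem QbarStar_exists_const_le (b : QbarStar X) : ∃ r, const r ≤ b.1 := by
  obtain ⟨b, m, hm, -⟩ := b
  exact ⟨-m, by rwa [const_neg, const_natCast]⟩

variable [T35Space X]

/-- `toQbar` involves the inverse of `restrictQ`; this rule computes it on representatives over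
`βX`, where both rings can be compared directly. -/
theorem toQbar_restrictQ (a : Q (StoneCech X)) : toQbar X (restrictQ X a) = inclQ X a :=
  congrArg (inclQ X)
    ((RingEquiv.ofBijective (restrictQ X) restrictQ_bijective).symm_apply_apply a)

theorem toQbar_le_iff {a b : Q X} : toQbar X a ≤ toQbar X b ↔ a ≤ b := by
  obtain ⟨a, rfl⟩ := restrictQ_bijective.2 a
  obtain ⟨b, rfl⟩ := restrictQ_bijective.2 b
  rw [toQbar_restrictQ, toQbar_restrictQ, restrictQ_le_iff]
  induction a, b using ind₂ with | h i f g => ?_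
  rw [inclQ_mk, inclQ_mk, mk_le_mk, mk_le_mk]

theorem continuousToQbar_le_iff {f g : C(X, ℝ)} :
    continuousToQbar X f ≤ continuousToQbar X g ↔ f ≤ g :=
  toQbar_le_iff.trans ofContinuous_le_ofContinuous

theorem continuousToQbar_comp_unit (f : C(StoneCech X, ℝ)) :
    continuousToQbar X (f.comp ⟨stoneCechUnit, continuous_stoneCechUnit⟩) = ofContinuous f :=
  (toQbar_restrictQ (ofContinuous f)).trans (inclQ_ofContinuous f)

theorem continuousToQbar_const (r : ℝ) :
    continuousToQbar X (ContinuousMap.const X r) = const r :=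
  continuousToQbar_comp_unit (ContinuousMap.const _ r)

/-! ### The metric completion of `Q(X)` -/

theorem isometry_toQbar : Isometry (toQbar X) := by
  have h1 : Isometry (restrictQ X) := isometry_pullback _ _ _ fun i y => by
    rw [mem_closure_iff]
    intro O hO hyO
    obtain ⟨O', hO', rfl⟩ := isOpen_induced_iff.1 hO
    obtain ⟨x, hx⟩ := denseRange_stoneCechUnit.exists_mem_open (hO'.inter i.mem.1)
      ⟨y.1, hyO, y.2⟩
    exact ⟨_, hx.1, ⟨x, hx.2⟩, rfl⟩
  have h2 : Isometry (inclQ X) := isometry_pullback _ _ _ fun i y =>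
    subset_closure ⟨y, rfl⟩
  refine Isometry.of_dist_eq fun a b => ?_
  obtain ⟨a, rfl⟩ := restrictQ_bijective.2 a
  obtain ⟨b, rfl⟩ := restrictQ_bijective.2 b
  rw [toQbar_restrictQ, toQbar_restrictQ, h1.dist_eq, h2.dist_eq]

theorem isMetricCompletion_toQbar : IsMetricCompletion (toQbar X) where
  isometry := isometry_toQbar
  denseRange := by
    refine Metric.dense_iff.2 fun b ε hε => ?_
    obtain ⟨i, f, rfl⟩ := exists_eq_mk b
    -- The approximant is defined on a dense open set, hence comes from `Q(βX)`, although `f` lives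
    -- only on a dense `G_δ`.
    obtain ⟨j, g, -, hg⟩ := exists_isLocallyConstant_approx i f (half_pos hε)
    refine ⟨_, ?_, restrictQ X (mk j g), rfl⟩
    rw [toQbar_restrictQ, inclQ_mk, Metric.mem_ball, dist_comm]
    rw [← mk_res (le_stageInter_left i (gdeltaStage j)) f,
      ← mk_res (le_stageInter_right i (gdeltaStage j)) g, dist_mk]
    exact lt_of_le_of_lt (stageDist_le _ _ _ (half_pos hε).le fun x =>
      (ratio_le_self _).trans (hg x.1 x.2.1 x.2.2)) (half_lt_self hε)
  complete := completeSpace_denseGdelta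

/-! ### Bumps, lower bounds and convexity for the subrings -/

theorem restrictQ_mk_mem_QL {j : Stage (denseOpen (StoneCech X))} {g : C(j.carrier, ℝ)}
    (hg : IsLocallyConstant g) : restrictQ X (mk j g) ∈ QL X :=
  ⟨_, _, hg.comp_continuous (continuous_stoneCechUnit.restrictPreimage), rfl⟩

theorem restrictQ_mk_mem_QF {j : Stage (denseOpen (StoneCech X))} {g : C(j.carrier, ℝ)}
    (hg : (Set.range g).Finite) : restrictQ X (mk j g) ∈ QF X :=
  ⟨_, _, hg.subset (Set.range_comp_subset_range (Set.restrictPreimage _ _) g), rfl⟩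

theorem toQbar_restrictQ_indicatorQ {O : Set (StoneCech X)} (hO : IsOpen O) :
    toQbar X (restrictQ X (indicatorQ hO)) = indicator hO :=
  (toQbar_restrictQ _).trans rfl

theorem indicatorQ_mem_QF {O : Set (StoneCech X)} (hO : IsOpen O) :
    restrictQ X (indicatorQ hO) ∈ QF X := by
  refine restrictQ_mk_mem_QF ((Set.toFinite {(0 : ℝ), 1}).subset ?_)
  rintro _ ⟨y, rfl⟩
  by_cases hy : y.1 ∈ O
  · exact Or.inr (indicatorMap_of_mem hO y hy)
  · exact Or.inl (indicatorMap_of_notMem hO y hy)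

theorem exists_mem_QF_const (r : ℝ) : ∃ c ∈ QF X, toQbar X c = const r := by
  refine ⟨restrictQ X (const r), restrictQ_mk_mem_QF ((Set.finite_singleton r).subset ?_),
    toQbar_restrictQ _⟩
  rintro _ ⟨y, rfl⟩; rfl

/-- The indicator of an open set has finite range and is its own bump, so no shrinking is needed. -/
theorem hasBumps_of_QF {A : Type u} [CommRing A] (φ : A →+* Qbar X)
    (h : ∀ a ∈ QF X, ∃ a', φ a' = toQbar X a) : HasBumps φ where
  exists_const r := by
    obtain ⟨c, hc, hcr⟩ := exists_mem_QF_const (X := X) r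
    exact (h c hc).imp fun a' ha' => ha'.trans hcr
  exists_bump O hO hne := by
    obtain ⟨e, he⟩ := h _ (indicatorQ_mem_QF hO)
    rw [toQbar_restrictQ_indicatorQ] at he
    exact ⟨e, O, hO, hne, subset_rfl, he.ge, he.le⟩

/-- Bumps are restrictions to `X` of cut-off functions on `βX`. These take values in `[0, 1]`, so
bounded functions suffice and one argument serves both `C(X)` and `C*(X)`. -/
theorem hasBumps_of_continuous {A : Type u} [CommRing A] (φ : A →+* Qbar X)
    (h : ∀ f ∈ CStar X, ∃ a, φ a = continuousToQbar X f) : HasBumps φ where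
  exists_const r := by
    obtain ⟨m, hm⟩ := exists_nat_ge |r|
    rw [abs_le] at hm
    obtain ⟨c, hc⟩ := h (ContinuousMap.const X r)
      ⟨m, fun x => by simpa using hm.1, fun x => by simpa using hm.2⟩
    exact ⟨c, hc.trans (continuousToQbar_const r)⟩
  exists_bump O hO hne := by
    obtain ⟨p, hp⟩ := hne
    obtain ⟨e, O', hO', hpO', h01, h0, h1⟩ := exists_bump hO hp
    obtain ⟨a, ha⟩ := h (e.comp ⟨stoneCechUnit, continuous_stoneCechUnit⟩)
      ⟨1, fun x => by simpa using le_trans (by norm_num) (h01 (stoneCechUnit x)).1,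
        fun x => by simpa using (h01 (stoneCechUnit x)).2⟩
    rw [continuousToQbar_comp_unit] at ha
    refine ⟨a, O', hO', ⟨p, hpO'⟩, fun y hy => ?_, ?_, ?_⟩
    · by_contra hyO
      exact zero_ne_one ((h0 y hyO).symm.trans (h1 y hy))
    · rw [ha, ofContinuous_eq_mk (indicatorStage hO'), indicator, mk_le_mk]
      intro y
      by_cases hy : y.1 ∈ O'
      · exact (indicatorMap_of_mem hO' y hy).le.trans (h1 _ hy).ge
      · exact (indicatorMap_of_notMem hO' y hy).le.trans (h01 y.1).1
    · rw [ha, ofContinuous_eq_mk (indicatorStage hO), indicator, mk_le_mk]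
      intro y
      by_cases hy : y.1 ∈ O
      · exact (h01 y.1).2.trans (indicatorMap_of_mem hO y hy).ge
      · exact (h0 y.1 hy).le.trans (indicatorMap_of_notMem hO y hy).ge

/-- A locally constant approximation within one, lowered by one. -/
theorem exists_mem_QL_le (b : Qbar X) : ∃ a ∈ QL X, toQbar X a ≤ b := by
  obtain ⟨i, f, rfl⟩ := exists_eq_mk b
  obtain ⟨j, g, hg, hfg⟩ := exists_isLocallyConstant_approx i f zero_lt_one
  refine ⟨restrictQ X (mk j (g - 1)),
    restrictQ_mk_mem_QL (hg.sub (IsLocallyConstant.const 1)), ?_⟩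
  rw [toQbar_restrictQ, inclQ_mk, mk_le_mk_iff]
  intro y hj hi
  have := (abs_le.1 (hfg y hi hj)).1
  change g ⟨y, hj⟩ - 1 ≤ f ⟨y, hi⟩
  linarith

theorem mem_CBounded_of_le_of_le {a b c : Qbar X} (ha : a ∈ CBounded X) (hc : c ∈ CBounded X)
    (hab : a ≤ b) (hbc : b ≤ c) : b ∈ CBounded X := by
  obtain ⟨g, hg⟩ := ha
  obtain ⟨k, hk⟩ := hc
  have hg0 := (abs_nonneg a).trans hg
  have hk0 := (abs_nonneg c).trans hk
  refine ⟨g + k, ?_⟩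
  rw [abs_le'] at hg hk ⊢
  rw [map_add]
  exact ⟨(hbc.trans hk.1).trans (le_add_of_nonneg_left hg0),
    ((neg_le_neg hab).trans hg.2).trans (le_add_of_nonneg_right hk0)⟩

/-! ### The six Dedekind completions -/

theorem isDedekindCompletion_qlToQbar : IsDedekindCompletion (qlToQbar X) :=
  HasBumps.isDedekindCompletion (ι := RingHom.id (Qbar X))
    (hasBumps_of_QF _ fun a ha => ⟨⟨a, QF_le_QL ha⟩, rfl⟩) (fun _ _ => Iff.rfl)
    (fun _ _ b _ _ => ⟨b, rfl⟩) (fun _ _ => toQbar_le_iff)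
    fun b => (exists_mem_QL_le b).elim fun a ha => ⟨⟨a, ha.1⟩, ha.2⟩

theorem isDedekindCompletion_toQbar : IsDedekindCompletion (toQbar X) :=
  HasBumps.isDedekindCompletion (ι := RingHom.id (Qbar X))
    (hasBumps_of_QF _ fun a _ => ⟨a, rfl⟩) (fun _ _ => Iff.rfl)
    (fun _ _ b _ _ => ⟨b, rfl⟩) (fun _ _ => toQbar_le_iff)
    fun b => (exists_mem_QL_le b).imp fun _ ha => ha.2

theorem isDedekindCompletion_qfToQbarStar : IsDedekindCompletion (qfToQbarStar X) :=
  HasBumps.isDedekindCompletion (ι := (QbarStar X).subtype)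
    (hasBumps_of_QF _ fun a ha => ⟨⟨a, ha⟩, rfl⟩) (fun _ _ => Iff.rfl)
    (fun a c b hab hbc => ⟨⟨b, mem_QbarStar_of_le_of_le a.2 c.2 hab hbc⟩, rfl⟩)
    (fun _ _ => toQbar_le_iff) fun b => by
      obtain ⟨r, hr⟩ := QbarStar_exists_const_le b
      obtain ⟨c, hc, hcr⟩ := exists_mem_QF_const (X := X) r
      exact ⟨⟨c, hc⟩, hcr.le.trans hr⟩

theorem isDedekindCompletion_qstarToQbarStar : IsDedekindCompletion (qstarToQbarStar X) :=
  HasBumps.isDedekindCompletion (ι := (QbarStar X).subtype)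
    (hasBumps_of_QF _ fun a ha => ⟨⟨a, QF_le_Qstar ha⟩, rfl⟩) (fun _ _ => Iff.rfl)
    (fun a c b hab hbc => ⟨⟨b, mem_QbarStar_of_le_of_le a.2 c.2 hab hbc⟩, rfl⟩)
    (fun _ _ => toQbar_le_iff) fun b => by
      obtain ⟨r, hr⟩ := QbarStar_exists_const_le b
      obtain ⟨c, hc, hcr⟩ := exists_mem_QF_const (X := X) r
      exact ⟨⟨c, QF_le_Qstar hc⟩, hcr.le.trans hr⟩

theorem isDedekindCompletion_continuousToCBounded :
    IsDedekindCompletion (continuousToCBounded X) :=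
  HasBumps.isDedekindCompletion (ι := (CBounded X).subtype)
    (hasBumps_of_continuous _ fun f _ => ⟨f, rfl⟩) (fun _ _ => Iff.rfl)
    (fun a c b hab hbc => ⟨⟨b, mem_CBounded_of_le_of_le a.2 c.2 hab hbc⟩, rfl⟩)
    (fun _ _ => continuousToQbar_le_iff) fun b => by
      obtain ⟨b, g, hg⟩ := b
      refine ⟨-g, ?_⟩
      change continuousToQbar X (-g) ≤ b
      rw [map_neg]
      exact neg_le.1 (abs_le'.1 hg).2

theorem isDedekindCompletion_cstarToQbarStar : IsDedekindCompletion (cstarToQbarStar X) :=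
  HasBumps.isDedekindCompletion (ι := (QbarStar X).subtype)
    (hasBumps_of_continuous _ fun f hf => ⟨⟨f, hf⟩, rfl⟩) (fun _ _ => Iff.rfl)
    (fun a c b hab hbc => ⟨⟨b, mem_QbarStar_of_le_of_le a.2 c.2 hab hbc⟩, rfl⟩)
    (fun _ _ => continuousToQbar_le_iff) fun b => by
      obtain ⟨b, m, hm, -⟩ := b
      refine ⟨⟨-m, neg_mem (natCast_mem _ m)⟩, ?_⟩
      change continuousToQbar X (-m) ≤ b
      rwa [map_neg, map_natCast]

end

/-! ### The maximal ring of quotients of `C(X)` -/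

section

open LimitRing

variable {X : Type u} [TopologicalSpace X]

/-- Near a point where `b'` is nonzero, `b` agrees with a continuous function `h` on `βX`. A bump
`e` supported in that neighbourhood is the multiplier: `b e` is the restriction of `h e`, and `b' e`
is still nonzero at the point. -/
theorem isRingOfQuotients_ofContinuous [T35Space X] :
    IsRingOfQuotients (ofContinuous : C(X, ℝ) →+* Q X) where
  injective := ofContinuous_injective
  exists_mul b b' := by
    induction b, b' using ind₂ with | h i f g => ?_
    intro hg
    obtain ⟨x, hx⟩ : ∃ x, g x ≠ 0 := by
      by_contra! h
      exact hg ((congrArg (mk i) (ContinuousMap.ext h : g = 0)).trans (mk_zero i))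
    obtain ⟨O, hO, hxO, h, hh⟩ := exists_local_extension i.mem.1 f x
    obtain ⟨e, O', -, hxO', -, he0, he1⟩ := exists_bump hO hxO
    refine ⟨e.comp ⟨stoneCechUnit, continuous_stoneCechUnit⟩,
      ⟨(h * e).comp ⟨stoneCechUnit, continuous_stoneCechUnit⟩, ?_⟩, fun h0 => ?_⟩
    · rw [ofContinuous_eq_mk i, ofContinuous_eq_mk i, mk_mul]
      refine congrArg _ (ContinuousMap.ext fun z => ?_)
      change h (stoneCechUnit z.1) * e (stoneCechUnit z.1) = f z * e (stoneCechUnit z.1)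
      by_cases hz : stoneCechUnit z.1 ∈ O
      · rw [hh z hz]
      · rw [he0 _ hz, mul_zero, mul_zero]
    · rw [ofContinuous_eq_mk i, mk_mul, ← mk_zero i] at h0
      have h1 : g x * e (stoneCechUnit x.1) = 0 := DFunLike.congr_fun (mk_injective i h0) x
      rw [he1 _ hxO', mul_one] at h1
      exact hx h1

/-- A compatible family of fractions `c / a` of continuous functions whose denominators have only
the zero annihilator defines an element of `Q(X)`. -/
theorem exists_mul_ofContinuous_eq [CompletelyRegularSpace X] (I : Set (C(X, ℝ) × C(X, ℝ)))
    (hcomp : ∀ p ∈ I, ∀ q ∈ I, p.2 * q.1 = q.2 * p.1)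
    (hd : ∀ a : C(X, ℝ), a ≠ 0 → ∃ p ∈ I, a * p.1 ≠ 0) :
    ∃ q : Q X, ∀ p ∈ I, q * ofContinuous p.1 = ofContinuous p.2 := by
  let V : Set X := {x | ∃ p ∈ I, p.1 x ≠ 0}
  have hV : IsOpen V := by
    have : V = ⋃ p ∈ I, {x | p.1 x ≠ 0} := by ext; simp [V]
    rw [this]
    exact isOpen_biUnion fun p _ => isOpen_ne_fun p.1.continuous continuous_const
  have hVd : Dense V := by
    rw [dense_iff_inter_open]
    rintro O hO ⟨x, hx⟩
    by_contra hemp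
    obtain ⟨e, O', -, hx', -, he0, he1⟩ := exists_bump hO hx
    -- A bump supported in an open set missing `V` would be a nonzero function annihilating every
    -- denominator.
    obtain ⟨p, hp, hne⟩ := hd e fun h => zero_ne_one <| by
      rw [← he1 x hx', h]; rfl
    refine hne (ContinuousMap.ext fun y => ?_)
    change e y * p.1 y = 0
    by_cases hy : y ∈ O
    · have : p.1 y = 0 := by
        by_contra hne
        exact hemp ⟨y, hy, p, hp, hne⟩
      rw [this, mul_zero]
    · rw [he0 y hy, zero_mul]
  choose! p hp hne using fun x (hx : x ∈ V) => hx
  let F : V → ℝ := fun x => (p x.1).2 x.1 / (p x.1).1 x.1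
  have hF : ∀ q ∈ I, ∀ x : V, F x * q.1 x = q.2 x := fun q hq x => by
    have h : (p x.1).2 x.1 * q.1 x.1 = q.2 x.1 * (p x.1).1 x.1 :=
      DFunLike.congr_fun (hcomp _ (hp x.1 x.2) q hq) x.1
    have h0 := hne x.1 x.2
    simp only [F]
    rw [div_mul_eq_mul_div, h, mul_div_cancel_right₀ _ h0]
  have hFc : Continuous F := by
    rw [continuous_iff_continuousAt]
    intro x
    have hx := hne x.1 x.2
    have hc1 : Continuous fun z : V => (p x.1).1 z.1 :=
      (p x.1).1.continuous.comp continuous_subtype_val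
    have hc2 : Continuous fun z : V => (p x.1).2 z.1 :=
      (p x.1).2.continuous.comp continuous_subtype_val
    -- The fraction used at `z` varies with `z`, but by compatibility the one chosen at `x` gives
    -- the same value wherever its denominator is nonzero.
    have : (fun z : V => (p x.1).2 z.1 / (p x.1).1 z.1) =ᶠ[𝓝 x] F := by
      filter_upwards [(isOpen_ne_fun hc1 continuous_const).mem_nhds hx] with z hz
      rw [div_eq_iff hz, hF _ (hp x.1 x.2)]
    exact (hc2.continuousAt.div hc1.continuousAt hx).congr this
  let i : Stage (denseOpen X) := ⟨V, hV, hVd⟩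
  refine ⟨mk i ⟨F, hFc⟩, fun q hq => ?_⟩
  rw [ofContinuous_eq_mk i, ofContinuous_eq_mk i, mk_mul]
  exact congrArg _ (ContinuousMap.ext fun x => hF q hq x)

/-- The denominators of `b ∈ B'` detect zero in `B`. If `q ≠ 0`, some multiple `q a₀` is a nonzero
`c₀` in `A`, and some denominator `a` of `b` has `c₀ a ≠ 0`; but `q a = 0` forces `c₀ a = 0`. -/
theorem IsRingOfQuotients.eq_zero_of_mul_eq_zero {A B B' : Type u} [CommRing A] [CommRing B]
    [CommRing B'] {φ : A →+* B} {ψ : A →+* B'} (hφ : IsRingOfQuotients φ)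
    (hψ : IsRingOfQuotients ψ) (b : B') (q : B)
    (h : ∀ a c, b * ψ a = ψ c → q * φ a = 0) : q = 0 := by
  by_contra hq
  obtain ⟨a₀, ⟨c₀, hc₀⟩, hne⟩ := hφ.exists_mul q q hq
  have hc : c₀ ≠ 0 := by rintro rfl; exact hne (by rw [← hc₀, map_zero])
  obtain ⟨a, ⟨c, hc'⟩, hne'⟩ := hψ.exists_mul b (ψ c₀)
    ((map_ne_zero_iff ψ hψ.injective).2 hc)
  rw [← map_mul] at hne'
  refine hne' ((map_eq_zero_iff ψ hψ.injective).2 (hφ.injective ?_))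
  rw [map_mul, hc₀, map_zero]
  linear_combination φ a₀ * h a c hc'.symm

/-- `θ b` is the element with `θ b · a = c` whenever `b a = c`. The denominators of `b` detect zero,
which makes it unique and forces `θ` to be a homomorphism. -/
theorem isMaximalRingOfQuotients_ofContinuous [T35Space X] :
    IsMaximalRingOfQuotients (ofContinuous : C(X, ℝ) →+* Q X) where
  isRingOfQuotients := isRingOfQuotients_ofContinuous
  exists_embedding B' _ ψ hψ := by
    have hφ := isRingOfQuotients_ofContinuous (X := X)
    set φ : C(X, ℝ) →+* Q X := ofContinuous
    have hzero := hφ.eq_zero_of_mul_eq_zero hψ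
    have hex : ∀ b : B', ∃ q : Q X, ∀ a c, b * ψ a = ψ c → q * φ a = φ c := fun b => by
      obtain ⟨q, hq⟩ := exists_mul_ofContinuous_eq {p : C(X, ℝ) × C(X, ℝ) | b * ψ p.1 = ψ p.2}
        (fun p (hp : b * ψ p.1 = ψ p.2) q (hq : b * ψ q.1 = ψ q.2) => hψ.injective (by
          rw [map_mul, map_mul, ← hp, ← hq]; ring))
        (fun a ha => by
          obtain ⟨d, ⟨c, hc⟩, hne⟩ := hψ.exists_mul b (ψ a)
            ((map_ne_zero_iff ψ hψ.injective).2 ha)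
          exact ⟨(d, c), hc.symm, fun h => hne (by rw [← map_mul, h, map_zero])⟩)
      exact ⟨q, fun a c h => hq (a, c) h⟩
    choose θ hθ using hex
    have hbase : ∀ c, θ (ψ c) = φ c := fun c => by
      refine sub_eq_zero.1 (hzero (ψ c) _ fun a d h => ?_)
      have h' : c * a = d := hψ.injective (by rw [map_mul, h])
      rw [sub_mul, hθ _ a d h, ← map_mul, h', sub_self]
    have hadd : ∀ b b', θ (b + b') = θ b + θ b' := fun b b' => by
      -- After multiplication by denominators of `b`, `b'` and `b + b'`, the claim is an identity in
      -- `C(X)`. It holds in `B'`, pulls back along the injective `ψ`, and is pushed forward by `φ`.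
      refine sub_eq_zero.1 (hzero b _ fun a₁ c₁ h₁ => hzero b' _ fun a₂ c₂ h₂ =>
        hzero (b + b') _ fun a₃ c₃ h₃ => ?_)
      have h : φ (c₃ * a₁ * a₂) = φ (c₁ * a₂ * a₃ + c₂ * a₁ * a₃) := congrArg φ (hψ.injective (by
        simp only [map_add, map_mul]
        rw [← h₁, ← h₂, ← h₃]; ring))
      simp only [map_add, map_mul] at h
      rw [← hθ _ _ _ h₁, ← hθ _ _ _ h₂, ← hθ _ _ _ h₃] at h
      linear_combination h
    have hmul : ∀ b b', θ (b * b') = θ b * θ b' := fun b b' => by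
      refine sub_eq_zero.1 (hzero b _ fun a₁ c₁ h₁ => hzero b' _ fun a₂ c₂ h₂ =>
        hzero (b * b') _ fun a₃ c₃ h₃ => ?_)
      have h : φ (c₃ * a₁ * a₂) = φ (c₁ * c₂ * a₃) := congrArg φ (hψ.injective (by
        simp only [map_mul]
        rw [← h₁, ← h₂, ← h₃]; ring))
      simp only [map_mul] at h
      rw [← hθ _ _ _ h₁, ← hθ _ _ _ h₂, ← hθ _ _ _ h₃] at h
      linear_combination h
    let Θ : B' →+* Q X :=
      { toFun := θ
        map_one' := by rw [← map_one ψ, hbase, map_one]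
        map_zero' := by rw [← map_zero ψ, hbase, map_zero]
        map_add' := hadd
        map_mul' := hmul }
    refine ⟨Θ, (injective_iff_map_eq_zero Θ).2 fun b hb => ?_, RingHom.ext hbase⟩
    by_contra hne
    -- A nonzero `b` has a nonzero multiple `b a = c` in `C(X)`, while `θ b = 0` gives `c = θ b · a
    -- = 0`.
    obtain ⟨a, ⟨c, hc⟩, hne'⟩ := hψ.exists_mul b b hne
    refine hne' ?_
    have h0 : φ c = 0 := by
      rw [← hθ b a c hc.symm, show θ b = 0 from hb, zero_mul]
    rw [← hc, (map_eq_zero_iff φ hφ.injective).1 h0, map_zero]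

end

end

end RingsOfFunctions

theorem mainTheorem5 (X : Type*) [TopologicalSpace X] [T35Space X] :
    -- the rings `Q(X)` and `Q̄(X)`
    RingsOfFunctions.IsMaximalRingOfQuotients
        (RingsOfFunctions.LimitRing.ofContinuous : C(X, ℝ) →+* RingsOfFunctions.Q X) ∧
      RingsOfFunctions.IsMetricCompletion (RingsOfFunctions.toQbar X) ∧
    -- `Q̄(X)` is the Dedekind completion of `Q_L(X)` and of `Q(X)`
      RingsOfFunctions.IsDedekindCompletion (RingsOfFunctions.qlToQbar X) ∧
      RingsOfFunctions.IsDedekindCompletion (RingsOfFunctions.toQbar X) ∧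
    -- `Q̄*(X)` is the Dedekind completion of `Q_F(X)` and of `Q*(X)`
      RingsOfFunctions.IsDedekindCompletion (RingsOfFunctions.qfToQbarStar X) ∧
      RingsOfFunctions.IsDedekindCompletion (RingsOfFunctions.qstarToQbarStar X) ∧
    -- the Dedekind completions of `C(X)` and of `C*(X)`
      RingsOfFunctions.IsDedekindCompletion (RingsOfFunctions.continuousToCBounded X) ∧
      RingsOfFunctions.IsDedekindCompletion (RingsOfFunctions.cstarToQbarStar X) :=
  ⟨RingsOfFunctions.isMaximalRingOfQuotients_ofContinuous,
    RingsOfFunctions.isMetricCompletion_toQbar,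
    RingsOfFunctions.isDedekindCompletion_qlToQbar,
    RingsOfFunctions.isDedekindCompletion_toQbar,
    RingsOfFunctions.isDedekindCompletion_qfToQbarStar,
    RingsOfFunctions.isDedekindCompletion_qstarToQbarStar,
    RingsOfFunctions.isDedekindCompletion_continuousToCBounded,
    RingsOfFunctions.isDedekindCompletion_cstarToQbarStar⟩
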